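/- **Square paths.** A square path of size $n$ is a lattice path from $(0,0)$ to $(n,n)$ with unit north and east steps which ends with an east step (or is empty, if $n=0$). Its area word $(a_1,\dots,a_n)$ is defined by: the $i$-th vertical step starts on the line $y=x+a_i$. Its shift is the maximal $s$ such that the path meets the line $y=x-s$; the line $y=x+i-s$ is the $i$-th diagonal. A partial labelling is $w\in\mathbb N^n$ ($0\in\mathbb N$) such that $a_i>a_{i-1}$ implies $w_i>w_{i-1}$; $a_1=0$ implies $w_1>0$; and (if $n>0$) some $i$ has $a_i=-s$ and $w_i>0$. An index $i$ is a contractible valley if either $i=1$ and ($a_1<-1$, or $a_1=-1$ and $w_1>0$), or $i>1$ and ($a_i<a_{i-1}$, or $a_i=a_{i-1}$ and $w_i>w_{i-1}$). A valley-decorated partially labelled square path is $\pi=(\pi,w,dv)$ with $dv$ a set of contractible valleys. Put $$\mathsf{area}(\pi)=\sum_i (a_i+s),\qquad \mathsf{dinv}(\pi)=\#\{i<j : (i,j)\text{ inversion},\ i\notin dv\}+\#\{i : a_i<0,\ w_i>0\}-\#dv,$$ where $(i,j)$, $i<j$, is an inversion if $a_i=a_j$ and $w_i<w_j$, or $a_i=a_j+1$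 and $w_i>w_j$. Let $x^\pi=\prod_i x_{w_i}$ with $x_0=1$. The diagonal word $\mathsf{dw}(\pi)$ is $\rho_\ell\cdots\rho_1\rho_0$, where $\rho_i$ lists the labels on the $i$-th diagonal in increasing order, labels of decorated valleys being marked by $\bullet$, with the order $c<c^\bullet<c+1$. **Schedule numbers.** Let $z$ be a marked word in the alphabet $\mathbb N$ with runs $\rho_\ell,\dots,\rho_0$ from left to right (maximal factors that are weakly increasing when the marks are disregarded); $\rho_i$ is empty for all other $i$. Let $z_i(c)$ and $z_i^\bullet(c)$ be the numbers of unmarked, respectively marked, $c$ in $\rho_i$, and let $\tilde\rho_i$ be the multiset of the unmarked letters of $\rho_i$. For $s\in\mathbb N$ let $$w_{i,s}(c)=\begin{cases}\#\{d\in\tilde\rho_i: d>c\}+\#\{d\in\tilde\rho_{i-1}: d<c\} & i>s,\\ \#\{d\in\tilde\rho_i: d>c\}+1-\delta_{c,0} & i=s,\\ \#\{d\in\tilde\rho_i: d<c\}+\#\{d\in\tilde\rho_{i+1}: d>c\} & i<s,\end{cases}$$ $$w^\bullet_{i,s}(c)=\#\{d\in\tilde\rho_i: d<c\}+\#\{d\in\tilde\rho_{i+1}: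 d>c\}-\delta_{c,0}\delta_{i,s-1},$$ $$b(z,s)=\sum_{i=0}^{s-1}\Big(\sum_{c\geq 1} z_i(c)-z^\bullet_{i-1}(0)\Big),\qquad z^\bullet_{-1}(0)=0.$$ Let $\mathsf{maj}(z)$ be the sum of the positions of the descents of $z$ (marks disregarded), and $x^z=\prod_{c\in z}x_c$ with $x_0=1$. The $q$-binomial $\binom{a}{k}_q$ ($a\ge -1$, $k\ge 0$) is $1$ for $k=0$ and $0$ for $k>\max(a,0)$. **Theorem.** Let $z$ be a marked word such that no run of $z$ contains a letter $c^\bullet$ immediately followed by an unmarked $c$ (so that each run is increasing for $c<c^\bullet<c+1$), and let $s\in\mathbb N$. If $z$ is non-empty, assume that its last run $\rho_0$ contains a positive letter, marked or not; if $z$ is empty, assume $s=0$. (The diagonal word $z$ of any valley-decorated partially labelled square path satisfies the conditions on $z$.) Then only finitely many valley-decorated partially labelled square paths have shift $s$ and diagonal word $z$, and $$\sum_{\substack{\mathsf{shift}(\pi)=s\\ \mathsf{dw}(\pi)=z}} q^{\mathsf{dinv}(\pi)}t^{\mathsf{area}(\pi)}x^\pi=t^{\mathsf{maj}(z)}q^{b(z,s)}\prod_{i=0}^{\ell}\left(\prod_{c\in\mathbb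 N}\binom{w_{i,s}(c)+z_i(c)-1}{z_i(c)}_q\,q^{\binom{z_i^\bullet(c)}{2}}\binom{w^\bullet_{i,s}(c)}{z^\bullet_i(c)}_q\right)x^z.$$ The identity holds for $t,x_1,x_2,\dots$ in any commutative ring and $q$ a unit of that ring, in particular for indeterminates over $\mathbb Z$. -/

import Mathlib

namespace ScheduleFormula

/-! ### Square paths -/

/-- A square path of size `n`: a lattice path with unit north and east steps from `(0,0)` to
`(n,n)` that ends with an east step (or is empty, if `n = 0`). It is recorded by the abscissae of
its vertical steps: the `i`-th vertical step (`i = 0, …, n-1`) goes from `(col i, i)` to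
`(col i, i+1)`. The abscissae increase weakly along the path, and the last step is an east step
exactly when all of them are smaller than `n`. -/
structure SquarePath (n : ℕ) where
  col : Fin n → ℕ
  col_mono : Monotone col
  col_lt : ∀ i, col i < n

namespace SquarePath

variable {n : ℕ} (π : SquarePath n)

/-- The lattice point `(x, y)` lies on the path: the vertical steps in the rows below height `y`
are weakly to the left of it, those in the rows above height `y` are weakly to its right. -/
def OnPath (x y : ℕ) : Prop :=
  x ≤ n ∧ y ≤ n ∧ (∀ i : Fin n, (i : ℕ) < y → π.col i ≤ x) ∧ (∀ i : Fin n, y ≤ i → x ≤ π.col i)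

/-- The shift: the maximal `s` such that the path meets the line `y = x - s`. -/
noncomputable def shift : ℕ := sSup {s : ℕ | ∃ y, π.OnPath (y + s) y}

/-- The area word: the `i`-th vertical step starts on the line `y = x + area i`. -/
def areaWord (i : Fin n) : ℤ := (i : ℤ) - (π.col i : ℤ)

end SquarePath

/-! ### Partial labellings -/

/-- A partially labelled square path. -/
structure LabelledSquarePath (n : ℕ) extends SquarePath n where
  label : Fin n → ℕ
  /-- Labels increase strictly from bottom to top in each column. -/
  label_lt : ∀ i j : Fin n, (i : ℕ) + 1 = j →
    toSquarePath.areaWord i < toSquarePath.areaWord j → label i < label j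
  /-- If the path starts with a north step, the first label is positive. -/
  first_pos : ∀ i : Fin n, (i : ℕ) = 0 → toSquarePath.areaWord i = 0 → 0 < label i
  /-- There is a positive label on the bottom-most diagonal (unless the path is empty). -/
  base_pos : 0 < n → ∃ i, toSquarePath.areaWord i = -(toSquarePath.shift : ℤ) ∧ 0 < label i

namespace LabelledSquarePath

variable {n : ℕ} (π : LabelledSquarePath n)

/-- Contractible valleys. -/
def IsContractibleValley (j : Fin n) : Prop :=
  ((j : ℕ) = 0 ∧ (π.areaWord j < -1 ∨ (π.areaWord j = -1 ∧ 0 < π.label j))) ∨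
  ∃ i : Fin n, (i : ℕ) + 1 = j ∧
    (π.areaWord j < π.areaWord i ∨ (π.areaWord j = π.areaWord i ∧ π.label i < π.label j))

end LabelledSquarePath

/-! ### Marked words -/

/-- A letter of the marked alphabet: a natural number, together with a boolean that tells whether
the letter is marked (decorated). The order is `c < c• < c + 1`. -/
abbrev MarkedLetter : Type := ℕ ×ₗ Bool

/-- The underlying natural number of a marked letter. -/
def MarkedLetter.val (a : MarkedLetter) : ℕ := (ofLex a).1

/-- Whether the letter is marked. -/
def MarkedLetter.marked (a : MarkedLetter) : Bool := (ofLex a).2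

/-- A marked word. -/
abbrev MarkedWord : Type := List MarkedLetter

/-- The runs `ρ_ℓ, …, ρ_0` of a marked word, from left to right: its maximal factors that are
weakly increasing when the marks are disregarded. -/
def runs (z : MarkedWord) : List MarkedWord := z.splitBy (fun a b => decide (a.val ≤ b.val))

/-- The run `ρ_i`; the runs are numbered from right to left, starting with `ρ_0`, and `ρ_i` is
empty for `i > ℓ`. -/
def run (z : MarkedWord) (i : ℕ) : MarkedWord := (runs z).reverse.getD i []

/-- The letters of `ρ_i` that are not marked. -/
def unmarkedRun (z : MarkedWord) (i : ℕ) : List ℕ :=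
  ((run z i).filter (fun a => a.marked = false)).map MarkedLetter.val

/-- The letters of `ρ_i` that are marked. -/
def markedRun (z : MarkedWord) (i : ℕ) : List ℕ :=
  ((run z i).filter (fun a => a.marked = true)).map MarkedLetter.val

/-- The run multiplicity `z_i(c)`: the number of unmarked `c` in `ρ_i`. -/
def mult (z : MarkedWord) (i c : ℕ) : ℕ := (unmarkedRun z i).count c

/-- The run multiplicity `z_i^•(c)`: the number of marked `c` in `ρ_i`. -/
def markedMult (z : MarkedWord) (i c : ℕ) : ℕ := (markedRun z i).count c

/-- The schedule number `w_{i,s}(c)`. -/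
def schedule (z : MarkedWord) (s i c : ℕ) : ℕ :=
  if s < i then
    (unmarkedRun z i).countP (fun d => c < d) + (unmarkedRun z (i - 1)).countP (fun d => d < c)
  else if i = s then
    (unmarkedRun z i).countP (fun d => c < d) + (if c = 0 then 0 else 1)
  else
    (unmarkedRun z i).countP (fun d => d < c) + (unmarkedRun z (i + 1)).countP (fun d => c < d)

/-- The schedule number `w^•_{i,s}(c)`. The subtraction is truncated: a value `-1` is replaced
by `0`, and the `q`-binomials with lower entry `k` and upper entry `-1` or `0` are both `1` if
`k = 0` and `0` if `k > 0`. -/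
def markedSchedule (z : MarkedWord) (s i c : ℕ) : ℕ :=
  (unmarkedRun z i).countP (fun d => d < c) + (unmarkedRun z (i + 1)).countP (fun d => c < d)
    - (if c = 0 ∧ i + 1 = s then 1 else 0)

/-- The exponent `b(z,s)`: the number of unmarked positive letters in `ρ_0, …, ρ_{s-1}`, minus the
number of marked zeros in `ρ_0, …, ρ_{s-2}`. -/
def bonus (z : MarkedWord) (s : ℕ) : ℤ :=
  ∑ i ∈ Finset.range s,
    (((unmarkedRun z i).countP (fun d => 0 < d) : ℤ)
      - (if i = 0 then 0 else (markedMult z (i - 1) 0 : ℤ)))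

/-- The major index of a sequence `p_1, …, p_k`: the sum of the `i` with `p_i > p_{i+1}`. -/
def majorIndex (p : List ℕ) : ℕ :=
  ∑ i ∈ Finset.range (p.length - 1), if p.getD (i + 1) 0 < p.getD i 0 then i + 1 else 0

/-- The major index of a marked word (marks are disregarded). -/
def maj (z : MarkedWord) : ℕ := majorIndex (z.map MarkedLetter.val)

/-- The Gaussian binomial coefficient `[n choose k]_q`, by the `q`-Pascal rule. -/
def qBinom {A : Type*} [CommRing A] (q : A) : ℕ → ℕ → A
  | _, 0 => 1
  | 0, _ + 1 => 0
  | n + 1, k + 1 => qBinom q n k + q ^ (k + 1) * qBinom q n (k + 1)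

/-- The variable attached to the letter `c`, with `x_0 = 1`. -/
def letterVar {A : Type*} [CommRing A] (x : ℕ → A) (c : ℕ) : A := if c = 0 then 1 else x c

/-- The monomial `x^z` of a marked word, with `x_0 = 1`. -/
def wordMonomial {A : Type*} [CommRing A] (x : ℕ → A) (z : MarkedWord) : A :=
  (z.map (fun a => letterVar x a.val)).prod

/-! ### Valley-decorated paths and their statistics -/

/-- A valley-decorated partially labelled square path. -/
structure DecoratedSquarePath (n : ℕ) extends LabelledSquarePath n where
  dv : Finset (Fin n)
  dv_valley : ∀ j ∈ dv, toLabelledSquarePath.IsContractibleValley j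

namespace DecoratedSquarePath

variable {n : ℕ} (π : DecoratedSquarePath n)

/-- The number `areaWord i + shift` of the diagonal on which the `i`-th vertical step starts,
diagonal `0` being the bottom-most one. -/
noncomputable def diagonal (i : Fin n) : ℕ := (π.areaWord i + (π.shift : ℤ)).toNat

/-- The area: the sum of `areaWord i + shift` over all rows. -/
noncomputable def area : ℕ := ∑ i, π.diagonal i

/-- `(i, j)` is a primary or secondary inversion. -/
def IsInversion (i j : Fin n) : Prop :=
  i < j ∧ ((π.areaWord i = π.areaWord j ∧ π.label i < π.label j) ∨
    (π.areaWord i = π.areaWord j + 1 ∧ π.label j < π.label i))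

open Classical in
/-- The dinv: the number of inversions `(i, j)` whose left entry is not a decorated valley, plus
the number of positive labels below the main diagonal, minus the number of decorated valleys. -/
noncomputable def dinv : ℤ :=
  ((Finset.univ.filter (fun p : Fin n × Fin n => π.IsInversion p.1 p.2 ∧ p.1 ∉ π.dv)).card : ℤ)
    + ((Finset.univ.filter (fun i : Fin n => π.areaWord i < 0 ∧ 0 < π.label i)).card : ℤ)
    - (π.dv.card : ℤ)

/-- The monomial `x^π`, with `x_0 = 1`. -/
def monomial {A : Type*} [CommRing A] (x : ℕ → A) : A := ∏ i, letterVar x (π.label i)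

/-- The label of the `i`-th vertical step, marked if `i` is a decorated valley. -/
def markedLabel (i : Fin n) : MarkedLetter := toLex (π.label i, decide (i ∈ π.dv))

/-- The word `ρ_d` of the marked labels on diagonal `d`, in increasing order. -/
noncomputable def diagonalRun (d : ℕ) : MarkedWord :=
  ((Finset.univ.filter (fun i : Fin n => π.diagonal i = d)).val.map π.markedLabel).sort (· ≤ ·)

/-- The diagonal word `ρ_ℓ ⋯ ρ_1 ρ_0`, where `ℓ` is the number of the highest diagonal
that contains the starting point of a vertical step. -/
noncomputable def diagonalWord : MarkedWord :=
  ((List.range (Finset.univ.sup π.diagonal + 1)).reverse.map π.diagonalRun).flatten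

end DecoratedSquarePath

/-- All valley-decorated partially labelled square paths, of any size, with shift `s` and
diagonal word `z`. -/
def pathsWith (s : ℕ) (z : MarkedWord) : Set (Σ n, DecoratedSquarePath n) :=
  {P | P.2.shift = s ∧ P.2.diagonalWord = z}

end ScheduleFormula

namespace ScheduleFormula

/-! ### Gaussian binomial coefficients -/

section QBinom

variable {A : Type*} [CommRing A] (q : A)

/-! A path is recorded by the word of its cells (area letter, label, mark). The words that occur are
the chains for `Follows` that start after `startCell` and stop before `stopCell`. Shift and diagonal
word together determine the multiset of cells, `allCells`, and every arrangement of it that is a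
chain comes from exactly one path (`bijOn_toCells`). On these paths the area is constant, equal to
`maj z`; so are the monomial and every part of the dinv except the number of inversions. What
remains is the sum of `q ^ invCount` over the chains with given cells (`sum_arrangements_cells`).

This sum is computed by inserting the distinct cells one after the other, each with all its copies:
undecorated cells on or above the main diagonal, upwards, with decreasing labels on each diagonal
(`sum_arrangements_high`); undecorated cells below it, downwards, with increasing labels on each
diagonal (`sum_arrangements_low`); decorated cells, upwards, with decreasing labels on each diagonal
(`sum_arrangements_marked`). With this order the admissible sites for the new cell create
consecutive numbers of new inversions, and how many sites there are does not depend on the chain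
built so far. Hence the generating function is multiplied by a fixed factor.

An undecorated cell can be repeated at a site, so `z` copies on `w` sites contribute the complete
homogeneous polynomial `h_z(1, q, …, q^(w-1))`, a Gaussian binomial with entries `w + z - 1` and `z`
(`sum_shuffles_repeated`). A decorated cell fits at most once into each site, so the elementary
polynomial `e_z` appears, that is `q^(z choose 2)` times a Gaussian binomial; there is a further
`q^z` if the cheapest site already costs one inversion (`sum_shuffles_distinct`). These further
powers of `q` and the constant part of the dinv combine to `q ^ bonus z s` (`bonus_eq`). -/

@[simp]
theorem qBinom_zero_right (n : ℕ) : qBinom q n 0 = 1 := by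
  cases n <;> rfl

theorem qBinom_succ_succ (n k : ℕ) :
    qBinom q (n + 1) (k + 1) = qBinom q n k + q ^ (k + 1) * qBinom q n (k + 1) := rfl

theorem qBinom_eq_zero_of_lt {n k : ℕ} (h : n < k) : qBinom q n k = 0 := by
  induction n generalizing k with
  | zero => obtain ⟨k, rfl⟩ : ∃ j, k = j + 1 := ⟨k - 1, by omega⟩; rfl
  | succ n ih =>
    obtain ⟨k, rfl⟩ : ∃ j, k = j + 1 := ⟨k - 1, by omega⟩
    rw [qBinom_succ_succ, ih (by omega), ih (by omega)]
    simp

@[simp]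
theorem qBinom_self (n : ℕ) : qBinom q n n = 1 := by
  induction n with
  | zero => rfl
  | succ n ih => rw [qBinom_succ_succ, ih, qBinom_eq_zero_of_lt q (Nat.lt_succ_self n)]; simp

/-- The `q`-Pascal rule that is dual to the defining one. -/
theorem qBinom_add_succ (a k : ℕ) :
    qBinom q (a + k + 1) (k + 1) = q ^ a * qBinom q (a + k) k + qBinom q (a + k) (k + 1) := by
  induction h : a + k generalizing a k with
  | zero =>
    obtain ⟨rfl, rfl⟩ : a = 0 ∧ k = 0 := by omega
    simp [qBinom]
  | succ m ih =>
    rcases a with _ | a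
    · obtain rfl : k = m + 1 := by omega
      rw [qBinom_self, qBinom_self, qBinom_eq_zero_of_lt q (Nat.lt_succ_self _)]
      simp
    rw [qBinom_succ_succ]
    rcases k with _ | k
    · obtain rfl : m = a := by omega
      have e := ih m 0 rfl
      rw [e]
      rw [qBinom_succ_succ] at e
      simp only [qBinom_zero_right] at e ⊢
      linear_combination e
    · have h2 : a + (k + 1) = m := by omega
      rw [qBinom_succ_succ q m k, qBinom_succ_succ q m (k + 1)]
      have e1 := ih (a + 1) k (by omega)
      have e2 := ih a (k + 1) (by omega)
      rw [qBinom_succ_succ] at e1 e2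
      linear_combination e1 + q ^ (k + 2) * e2

end QBinom

/-! ### Shuffling copies of a letter into a word -/

section Shuffle

variable {α : Type*}

/-- All words obtained from `L` by inserting `z` copies of `k`, each listed once if `k ∉ L`. -/
def shuffles (k : α) : List α → ℕ → List (List α)
  | L, 0 => [L]
  | [], z + 1 => [List.replicate (z + 1) k]
  | x :: T, z + 1 =>
    (shuffles k (x :: T) z).map (List.cons k) ++ (shuffles k T (z + 1)).map (List.cons x)
termination_by L z => L.length + z

@[simp]
theorem shuffles_zero (k : α) (L : List α) : shuffles k L 0 = [L] := by
  cases L <;> simp [shuffles]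

@[simp]
theorem shuffles_nil (k : α) (z : ℕ) : shuffles k [] z = [List.replicate z k] := by
  cases z <;> simp [shuffles]

theorem shuffles_cons_succ (k x : α) (T : List α) (z : ℕ) :
    shuffles k (x :: T) (z + 1) =
      (shuffles k (x :: T) z).map (List.cons k) ++ (shuffles k T (z + 1)).map (List.cons x) := by
  simp [shuffles]

theorem nodup_shuffles {k : α} {L : List α} (hk : k ∉ L) (z : ℕ) : (shuffles k L z).Nodup := by
  induction L generalizing z with
  | nil => simp
  | cons x T ih =>
    induction z with
    | zero => simp
    | succ z ihz =>
      rw [shuffles_cons_succ, List.nodup_append]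
      refine ⟨ihz.map (List.cons_injective), (ih (by grind) _).map List.cons_injective, ?_⟩
      grind

variable [DecidableEq α]

theorem mem_shuffles {k : α} {L l : List α} {z : ℕ} (hk : k ∉ L) :
    l ∈ shuffles k L z ↔ l.filter (fun x => x ≠ k) = L ∧ l.count k = z := by
  induction l generalizing L z with
  | nil =>
    cases L with
    | nil => cases z <;> simp [List.replicate_succ]
    | cons x T => cases z <;> simp [shuffles_cons_succ]
  | cons y l ih =>
    have h0 : ∀ L : List α, k ∉ L → l = L → l.filter (fun x => x ≠ k) = L ∧ l.count k = 0 := by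
      intro L hL h
      subst h
      exact ⟨List.filter_eq_self.2 (by grind), List.count_eq_zero.2 hL⟩
    by_cases hy : y = k
    · subst hy
      simp only [ne_eq, not_true_eq_false, decide_false, Bool.false_eq_true,
        not_false_eq_true, List.filter_cons_of_neg, List.count_cons_self]
      cases z with
      | zero => simp; grind
      | succ z =>
        cases L with
        | nil =>
          have := ih (L := []) (z := z) (by simp)
          simp only [shuffles_nil, List.mem_singleton] at this
          simp [List.replicate_succ, this]
        | cons x T =>
          have hx : x ≠ y := by grind
          simp only [shuffles_cons_succ, List.mem_append, List.mem_map, List.cons.injEq,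
            true_and, exists_eq_right]
          rw [ih hk]
          simp [hx]
    · simp only [ne_eq, hy, not_false_eq_true, decide_true, List.filter_cons_of_pos,
        List.count_cons_of_ne hy]
      cases L with
      | nil => cases z <;> simp [List.replicate_succ, hy]
      | cons x T =>
        have hT : k ∉ T := by grind
        cases z with
        | zero =>
          have := ih (L := T) (z := 0) hT
          simp only [shuffles_zero, List.mem_singleton] at this
          simp only [shuffles_zero, List.mem_singleton, List.cons.injEq, this]
          simp [and_assoc]
        | succ z =>
          have := ih (L := T) (z := z + 1) hT
          simp only [shuffles_cons_succ, List.mem_append, List.mem_map, List.cons.injEq]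
          have hky : ¬ k = y := fun h => hy h.symm
          simp [this, hky, and_comm, and_left_comm, eq_comm]

/-- The words with a given multiset of letters. -/
def arrangements (M : Multiset α) : Finset (List α) := M.lists.toFinset

@[simp]
theorem mem_arrangements {M : Multiset α} {l : List α} :
    l ∈ arrangements M ↔ (l : Multiset α) = M := by
  simp [arrangements, Multiset.mem_lists_iff, eq_comm]

variable {A : Type*} [CommRing A]

/-- Deleting every `k` maps the arrangements on the left to those of `M`, and the fibre over `L`
consists of the shuffles of `L`. This is the induction step of all three insertion arguments. -/
theorem sum_arrangements_add_replicate {k : α} {M : Multiset α} (hk : k ∉ M) (z : ℕ)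
    (f : List α → A) :
    ∑ l ∈ arrangements (M + Multiset.replicate z k), f l =
      ∑ L ∈ arrangements M, ((shuffles k L z).map f).sum := by
  have key : ∀ l : List α, (l : Multiset α) = M + Multiset.replicate z k ↔
      ((l.filter (fun x => x ≠ k) : List α) : Multiset α) = M ∧ l.count k = z := by
    intro l
    rw [← Multiset.filter_coe, ← Multiset.coe_count]
    have e : (l : Multiset α) = Multiset.filter (fun x => x ≠ k) (l : Multiset α)
        + Multiset.replicate (Multiset.count k (l : Multiset α)) k := by
      conv_lhs => rw [← Multiset.filter_add_not (fun x => x ≠ k) (l : Multiset α)]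
      simp only [ne_eq, not_not, Multiset.filter_eq']
    constructor
    · intro h
      rw [h]
      simp only [Multiset.filter_add, Multiset.count_add, Multiset.count_eq_zero_of_notMem hk,
        Multiset.count_replicate_self, zero_add, and_true]
      rw [Multiset.filter_eq_self.2 (by rintro a ha rfl; exact hk ha), Multiset.filter_eq_nil.2]
      · simp
      · intro a ha
        simp [Multiset.eq_of_mem_replicate ha]
    · rintro ⟨h1, h2⟩
      rw [e, h1, h2]
  rw [← Finset.sum_fiberwise_of_maps_to (s := arrangements (M + Multiset.replicate z k))
    (t := arrangements M) (g := fun l => l.filter (fun x => x ≠ k))]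
  · refine Finset.sum_congr rfl fun L hL => ?_
    have hkL : k ∉ L := by
      rw [mem_arrangements] at hL
      rwa [← hL, Multiset.mem_coe] at hk
    rw [← List.sum_toFinset _ (nodup_shuffles hkL z)]
    refine Finset.sum_congr ?_ fun _ _ => rfl
    ext l
    rw [mem_arrangements] at hL
    simp only [Finset.mem_filter, mem_arrangements, List.mem_toFinset, mem_shuffles hkL, key]
    constructor
    · rintro ⟨⟨-, h2⟩, h3⟩; exact ⟨h3, h2⟩
    · rintro ⟨h1, h2⟩; exact ⟨⟨by rw [h1, hL], h2⟩, h1⟩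
  · intro l hl
    rw [mem_arrangements] at hl ⊢
    exact ((key l).1 hl).1

end Shuffle

/-! ### Insertion of letters into chains -/

section Insertion

variable {α : Type*} {A : Type*} [CommRing A] (q : A)

/-- The number of pairs of positions `i < j` of a word whose letters are related by `att`. -/
def invCount (att : α → α → Prop) [DecidableRel att] : List α → ℕ
  | [] => 0
  | x :: T => T.countP (fun u => att x u) + invCount att T

/-- The weight `q ^ invCount` of a word, set to `0` unless the word is an `R`-chain when it is
preceded by `p` and followed by `e`. -/
def chainWeight (R att : α → α → Prop) [DecidableRel R] [DecidableRel att] (p e : α)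
    (l : List α) : A :=
  if List.IsChain R (p :: (l ++ [e])) then q ^ invCount att l else 0

variable {R att : α → α → Prop} [DecidableRel R] [DecidableRel att]

theorem chainWeight_cons (p e x : α) (l : List α) :
    chainWeight q R att p e (x :: l) =
      if R p x then q ^ l.countP (fun u => att x u) * chainWeight q R att x e l else 0 := by
  simp only [chainWeight, List.cons_append, List.isChain_cons_cons, invCount, pow_add]
  split_ifs <;> simp_all

theorem countP_of_mem_shuffles [DecidableEq α] {k : α} {L l : List α} {z : ℕ} (hk : k ∉ L)
    (P : α → Prop) [DecidablePred P] (hl : l ∈ shuffles k L z) :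
    l.countP (fun u => P u) = L.countP (fun u => P u) + if P k then z else 0 := by
  rw [mem_shuffles hk] at hl
  obtain ⟨rfl, rfl⟩ := hl
  clear hk
  induction l with
  | nil => simp
  | cons x l ih =>
    by_cases hx : x = k
    · subst hx
      by_cases hP : P x <;> simp_all <;> omega
    · by_cases hP : P x <;> simp_all <;> omega

/-- The words obtained from `x :: T` by inserting copies of `k`, weighted with the conditions of
`chainWeight`, decomposed according to their first letters. -/
theorem sum_shuffles_cons_succ [DecidableEq α] {k x : α} {T : List α} (hk : k ∉ x :: T) (p e : α)
    (z : ℕ) (hkk : ¬ att k k) :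
    ((shuffles k (x :: T) (z + 1)).map (chainWeight q R att p e)).sum =
      (if R p k then q ^ (x :: T).countP (fun u => att k u) *
        ((shuffles k (x :: T) z).map (chainWeight q R att k e)).sum else 0) +
      (if R p x then q ^ (T.countP (fun u => att x u) + if att x k then z + 1 else 0) *
        ((shuffles k T (z + 1)).map (chainWeight q R att x e)).sum else 0) := by
  rw [shuffles_cons_succ, List.map_append, List.sum_append, List.map_map, List.map_map]
  congr 1
  · split_ifs with h
    · rw [← List.sum_map_mul_left]
      congr 1
      refine List.map_congr_left fun l hl => ?_
      rw [Function.comp_apply, chainWeight_cons, if_pos h, countP_of_mem_shuffles hk _ hl]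
      simp [hkk]
    · apply List.sum_eq_zero
      intro a ha
      obtain ⟨l, -, rfl⟩ := List.mem_map.1 ha
      rw [Function.comp_apply, chainWeight_cons, if_neg h]
  · split_ifs with h h'
    · rw [← List.sum_map_mul_left]
      congr 1
      refine List.map_congr_left fun l hl => ?_
      rw [Function.comp_apply, chainWeight_cons, if_pos h,
        countP_of_mem_shuffles (by grind) _ hl]
      simp [h']
    · rw [← List.sum_map_mul_left]
      congr 1
      refine List.map_congr_left fun l hl => ?_
      rw [Function.comp_apply, chainWeight_cons, if_pos h,
        countP_of_mem_shuffles (by grind) _ hl]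
      simp [h']
    · apply List.sum_eq_zero
      intro a ha
      obtain ⟨l, -, rfl⟩ := List.mem_map.1 ha
      rw [Function.comp_apply, chainWeight_cons, if_neg h]

theorem chainWeight_replicate_succ (p e k : α) (z : ℕ) (hkk : ¬ att k k) :
    chainWeight q R att p e (List.replicate (z + 1) k) =
      if R p k then chainWeight q R att k e (List.replicate z k) else 0 := by
  rw [List.replicate_succ, chainWeight_cons]
  simp [List.countP_replicate, hkk]

/-- Inserting `z` copies of a letter `k` that may be followed by every other letter and by itself:
the copies are distributed freely behind the letters that may precede `k`. -/
theorem sum_shuffles_repeated [DecidableEq α] {k p e : α} {L : List α} (z : ℕ) (hk : k ∉ L)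
    (hkk : R k k) (hku : ∀ u ∈ e :: L, R k u)
    (htrans : ∀ p' ∈ p :: L, ∀ u ∈ e :: L, R p' k → R p' u)
    (akk : ¬ att k k) (auk : ∀ u ∈ L, ¬ att u k) (aku : ∀ u ∈ L, (att k u ↔ R u k)) :
    ((shuffles k L z).map (chainWeight q R att p e)).sum =
      chainWeight q R att p e L *
        qBinom q (L.countP (fun u => R u k) + (if R p k then 1 else 0) + z - 1) z := by
  -- A copy of `k` must stand behind a letter of `p :: L` that may precede `k`, or behind another
  -- copy at such a site. It attacks exactly the later letters of `L` that may precede `k`. So the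
  -- sites cost `0, 1, 2, …` inversions from right to left, and the copies are distributed over them
  -- with repetition. The induction removes the first letter of `L` and matches the dual Pascal
  -- rule.
  induction L generalizing p z with
  | nil =>
    have hke : R k e := hku e (by simp)
    have h1 : ∀ z, chainWeight q R att k e (List.replicate z k) = 1 := by
      intro z
      induction z with
      | zero => simp [chainWeight, invCount, hke]
      | succ z ih => rw [chainWeight_replicate_succ q k e k z akk, if_pos hkk, ih]
    cases z with
    | zero => simp
    | succ z =>
      simp only [shuffles_nil, List.map_cons, List.map_nil, List.sum_cons, List.sum_nil, add_zero,
        chainWeight_replicate_succ q p e k z akk, h1, List.countP_nil, zero_add]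
      by_cases hp : R p k
      · have hpe : R p e := htrans p (by simp) e (by simp) hp
        simp [hp, hpe, chainWeight, invCount, Nat.add_comm 1]
      · simp only [if_neg hp, zero_add, Nat.add_sub_cancel]
        rw [qBinom_eq_zero_of_lt q (Nat.lt_succ_self z), mul_zero]
  | cons x T ih =>
    have ihT : ∀ z, ((shuffles k T z).map (chainWeight q R att x e)).sum =
        chainWeight q R att x e T *
          qBinom q (T.countP (fun u => R u k) + (if R x k then 1 else 0) + z - 1) z := by
      intro z
      refine ih z (by grind) ?_ ?_ ?_ ?_
      · intro u hu; exact hku u (by grind)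
      · intro p' hp' u hu; exact htrans p' (by grind) u (by grind)
      · intro u hu; exact auk u (by grind)
      · intro u hu; exact aku u (by grind)
    have hc : (x :: T).countP (fun u => R u k) =
        T.countP (fun u => R u k) + (if R x k then 1 else 0) := by
      simp [List.countP_cons]
    have hatt : (x :: T).countP (fun u => att k u) = (x :: T).countP (fun u => R u k) :=
      List.countP_congr fun u hu => by simpa using aku u hu
    have hxk : ¬ att x k := auk x (by simp)
    have hkx : R k x := hku x (by simp)
    -- With a copy of `k` in front, the first site is always available because `R k k`; this fixes
    -- the upper entry of the binomial.
    have step : ∀ z, ((shuffles k (x :: T) z).map (chainWeight q R att k e)).sum =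
        chainWeight q R att k e (x :: T) *
          qBinom q ((x :: T).countP (fun u => R u k) + z) z := by
      intro z
      induction z with
      | zero => simp
      | succ z ihz =>
        rw [sum_shuffles_cons_succ q hk k e z akk, if_pos hkk, if_pos hkx, ihz, ihT, if_neg hxk,
          ← hc, hatt, ← Nat.add_assoc, qBinom_add_succ, Nat.add_sub_cancel, chainWeight_cons,
          if_pos hkx, add_zero]
        ring
    cases z with
    | zero => simp
    | succ z =>
      rw [sum_shuffles_cons_succ q hk p e z akk, ihT, step, if_neg hxk, ← hc, hatt,
        ← Nat.add_assoc, Nat.add_sub_cancel, add_zero, chainWeight_cons, chainWeight_cons,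
        if_pos hkx]
      by_cases hp : R p k
      · have hpx : R p x := htrans p (by simp) x (by simp) hp
        rw [if_pos hp, if_pos hp, if_pos hpx, if_pos hpx,
          show ∀ a : ℕ, a + 1 + (z + 1) - 1 = a + z + 1 from fun a => by omega, qBinom_add_succ]
        ring
      · rw [if_neg hp, if_neg hp]
        split_ifs <;> simp [← Nat.add_assoc, mul_assoc]

/-- The number of consecutive pairs `(p, u)` of a word between which `k` can be inserted. -/
def slots (R : α → α → Prop) [DecidableRel R] (k e : α) : α → List α → ℕ
  | p, [] => if R p k ∧ R k e then 1 else 0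
  | p, x :: T => (if R p k ∧ R k x then 1 else 0) + slots R k e x T

/-- Inserting `z` copies of a letter `k` that cannot be repeated. -/
theorem sum_shuffles_distinct [DecidableEq α] {k p e : α} {L : List α} (z : ℕ) (hk : k ∉ L)
    (hkk : ¬ R k k) (htotal : ∀ u ∈ p :: L, R u k ∨ R k u)
    (htrans : ∀ p' ∈ p :: L, ∀ u ∈ e :: L, R p' k → R k u → R p' u)
    (hsplit : ∀ p' ∈ p :: L, ∀ u ∈ e :: L, R p' u → R p' k ∨ R k u)
    (akk : ¬ att k k) (aku : ∀ u ∈ L, ¬ att k u) (auk : ∀ u ∈ L, (att u k ↔ R u k ∧ R k u)) :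
    ((shuffles k L z).map (chainWeight q R att p e)).sum =
      chainWeight q R att p e L *
        (q ^ ((if R p k then 0 else z) + z.choose 2) * qBinom q (slots R k e p L) z) := by
  -- Since `k` cannot follow itself, the copies occupy different slots. A copy is attacked by the
  -- earlier letters that may both precede and follow `k`. In a chain, `hsplit` forces exactly one
  -- such letter between two consecutive slots, and one before the first slot precisely when `p` may
  -- not precede `k`. So the slot costs are consecutive, starting at `0` or `1`.
  induction L generalizing p z with
  | nil =>
    rcases z with _ | _ | z
    · simp
    · simp only [shuffles_nil, List.map_cons, List.map_nil, List.sum_cons, List.sum_nil, add_zero,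
        chainWeight_replicate_succ q p e k 0 akk, slots]
      by_cases hp : R p k
      · by_cases he : R k e
        · have := htrans p (by simp) e (by simp) hp he
          simp [chainWeight, invCount, hp, he, this]
        · simp [chainWeight, hp, he, qBinom_eq_zero_of_lt]
      · simp [hp, qBinom_eq_zero_of_lt]
    · simp only [shuffles_nil, List.map_cons, List.map_nil, List.sum_cons, List.sum_nil, add_zero,
        chainWeight_replicate_succ q p e k (z + 1) akk, chainWeight_replicate_succ q k e k z akk,
        if_neg hkk, ite_self, slots]
      rw [qBinom_eq_zero_of_lt q (by split_ifs <;> omega)]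
      simp
  | cons x T ih =>
    have ihT : ∀ z, ((shuffles k T z).map (chainWeight q R att x e)).sum =
        chainWeight q R att x e T *
        (q ^ ((if R x k then 0 else z) + z.choose 2) * qBinom q (slots R k e x T) z) := by
      intro z
      refine ih z (by grind) ?_ ?_ ?_ ?_ ?_
      · intro u hu; exact htotal u (by grind)
      · intro p' hp' u hu; exact htrans p' (by grind) u (by grind)
      · intro p' hp' u hu; exact hsplit p' (by grind) u (by grind)
      · intro u hu; exact aku u (by grind)
      · intro u hu; exact auk u (by grind)
    have hcount : (x :: T).countP (fun u => att k u) = 0 := by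
      rw [List.countP_eq_zero]
      intro u hu
      simpa using aku u hu
    have hx := auk x (by simp)
    have hxt := htotal x (by simp)
    have step : ∀ z, ((shuffles k (x :: T) z).map (chainWeight q R att k e)).sum =
        if R k x then q ^ (T.countP (fun u => att x u) + if att x k then z else 0) *
          ((shuffles k T z).map (chainWeight q R att x e)).sum else 0 := by
      intro z
      cases z with
      | zero => simp [chainWeight_cons]
      | succ z => rw [sum_shuffles_cons_succ q hk k e z akk, if_neg hkk, zero_add]
    cases z with
    | zero => simp
    | succ z =>
      rw [sum_shuffles_cons_succ q hk p e z akk, step, ihT, ihT, hcount, chainWeight_cons, slots,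
        pow_zero, one_mul]
      have ht := htrans p (by simp) x (by simp)
      have hs := hsplit p (by simp) x (by simp)
      have hch : (z + 1).choose 2 = z + z.choose 2 := by
        rw [Nat.choose_succ_succ' z 1, Nat.choose_one_right]
      by_cases hp : R p k
      · by_cases hkx : R k x
        · have hpx := ht hp hkx
          simp only [hp, hkx, hpx, if_true, and_true] at hx ⊢
          rw [Nat.add_comm 1, qBinom_succ_succ, hch]
          by_cases hxk : R x k
          · simp only [hxk, hx, if_true]
            ring
          · simp only [hxk, hx, if_false]
            ring
        · have hxk : R x k := hxt.resolve_right hkx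
          have : ¬ att x k := fun h => hkx (hx.1 h).2
          simp only [hp, hkx, hxk, this, if_true, if_false, and_false, zero_add]
          split_ifs <;> ring
      · simp only [hp, if_false, false_and, zero_add]
        by_cases hpx : R p x
        · have hkx := (hs hpx).resolve_left hp
          simp only [hkx, and_true] at hx
          simp only [hpx, if_true]
          by_cases hxk : R x k
          · simp only [hxk, hx, if_true]
            ring
          · simp only [hxk, hx, if_false]
            ring
        · simp [hpx]

/-- The number of slots of a chain, in terms of its letters. -/
theorem slots_add {k p e : α} {L : List α} (htotal : ∀ u ∈ p :: L, R u k ∨ R k u)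
    (hsplit : ∀ p' ∈ p :: L, ∀ u ∈ e :: L, R p' u → R p' k ∨ R k u)
    (hL : List.IsChain R (p :: (L ++ [e]))) :
    slots R k e p L + (if R k e then 0 else 1) =
      L.countP (fun u => R u k ∧ R k u) + (if R p k then 1 else 0) := by
  induction L generalizing p with
  | nil =>
    have := hsplit p (by simp) e (by simp) (by simpa using hL)
    by_cases h1 : R p k <;> by_cases h2 : R k e <;> simp_all [slots]
  | cons x T ih =>
    simp only [List.cons_append, List.isChain_cons_cons] at hL
    have := ih (p := x) (fun u hu => htotal u (by grind))
      (fun p' hp' u hu => hsplit p' (by grind) u (by grind)) hL.2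
    have h1 := hsplit p (by simp) x (by simp) hL.1
    have h2 := htotal x (by simp)
    simp only [slots, List.countP_cons, decide_eq_true_eq]
    generalize slots R k e x T = a at *
    generalize T.countP _ = b at *
    clear ih hL htotal hsplit
    split_ifs at this ⊢ <;> first | omega | tauto

end Insertion

/-! ### Words of cells -/

/-- The datum of a vertical step of a path: the corresponding letter of the area word, the label,
and whether the step is a decorated valley. -/
abbrev Cell : Type := ℤ × ℕ × Bool

/-- The step `u` may come directly after the step `p`. -/
def Follows (p u : Cell) : Prop :=
  u.1 < p.1 ∨ (u.1 = p.1 ∧ (u.2.2 = true → p.2.1 < u.2.1)) ∨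
    (u.1 = p.1 + 1 ∧ u.2.2 = false ∧ p.2.1 < u.2.1)

instance : DecidableRel Follows := fun p u => by unfold Follows; infer_instance

/-- The step `x` forms an inversion with every later step `u` with this property. -/
def Attacks (x u : Cell) : Prop :=
  x.2.2 = false ∧ ((x.1 = u.1 ∧ x.2.1 < u.2.1) ∨ (x.1 = u.1 + 1 ∧ u.2.1 < x.2.1))

instance : DecidableRel Attacks := fun p u => by unfold Attacks; infer_instance

/-- A cell that may precede exactly the cells that can be the first of a path. -/
def startCell : Cell := (-1, 0, false)

/-- A cell that may come after exactly the cells that can be the last of a path, provided that all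
labels are smaller than `N`. -/
def stopCell (N : ℕ) : Cell := (1, N, false)

/-- The order in which cells are inserted. -/
def Cell.key (u : Cell) : ℤ ×ₗ ℤ := toLex (u.1, -(u.2.1 : ℤ))

theorem Cell.key_le_key {u v : Cell} :
    u.key ≤ v.key ↔ u.1 < v.1 ∨ (u.1 = v.1 ∧ v.2.1 ≤ u.2.1) := by
  rw [Cell.key, Cell.key, Prod.Lex.toLex_le_toLex]
  simp

theorem Cell.ext_iff' {u v : Cell} : u = v ↔ u.1 = v.1 ∧ u.2.1 = v.2.1 ∧ u.2.2 = v.2.2 := by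
  rw [Prod.ext_iff, Prod.ext_iff]

theorem follows_of_unmarked {p u : Cell} (h : u.2.2 = false) :
    Follows p u ↔ u.1 ≤ p.1 ∨ (u.1 = p.1 + 1 ∧ p.2.1 < u.2.1) := by
  simp only [Follows, h, Bool.false_eq_true, false_implies, true_and, and_true]
  omega

theorem follows_of_marked {p u : Cell} (h : u.2.2 = true) :
    Follows p u ↔ u.1 < p.1 ∨ (u.1 = p.1 ∧ p.2.1 < u.2.1) := by
  simp [Follows, h]

theorem attacks_of_unmarked {x u : Cell} (h : x.2.2 = false) :
    Attacks x u ↔ (x.1 = u.1 ∧ x.2.1 < u.2.1) ∨ (x.1 = u.1 + 1 ∧ u.2.1 < x.2.1) := by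
  simp [Attacks, h]

theorem not_attacks_of_marked {x u : Cell} (h : x.2.2 = true) : ¬ Attacks x u := by
  simp [Attacks, h]

/-! ### Removing all copies of one element from a multiset. -/

section Multiset

variable {α : Type*} [DecidableEq α]

theorem filter_ne_add_replicate (M : Multiset α) (k : α) :
    M.filter (fun x => x ≠ k) + Multiset.replicate (M.count k) k = M := by
  conv_rhs => rw [← Multiset.filter_add_not (fun x => x ≠ k) M]
  simp only [ne_eq, not_not, Multiset.filter_eq']

theorem toFinset_filter_ne {M : Multiset α} {k : α} {S : Finset α} (hk : k ∉ S)
    (h : M.toFinset = insert k S) : (M.filter (fun x => x ≠ k)).toFinset = S := by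
  rw [Multiset.toFinset_filter, h]
  ext x
  simp only [Finset.mem_filter, Finset.mem_insert]
  constructor
  · rintro ⟨h1 | h1, h2⟩
    · exact absurd h1 h2
    · exact h1
  · intro hx
    exact ⟨Or.inr hx, fun h => hk (h ▸ hx)⟩

theorem countP_filter_ne {M : Multiset α} {k : α} {P : α → Prop} [DecidablePred P] (h : ¬ P k) :
    (M.filter (fun x => x ≠ k)).countP P = M.countP P := by
  conv_rhs => rw [← filter_ne_add_replicate M k]
  rw [Multiset.countP_add, left_eq_add, Multiset.countP_eq_zero]
  intro a ha
  rwa [Multiset.eq_of_mem_replicate ha]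

theorem count_filter_ne {M : Multiset α} {k v : α} (h : v ≠ k) :
    (M.filter (fun x => x ≠ k)).count v = M.count v :=
  Multiset.count_filter_of_pos h

theorem countP_eq_of_mem_arrangements {M : Multiset α} {L : List α} (hL : L ∈ arrangements M)
    (P : α → Prop) [DecidablePred P] : L.countP (fun u => P u) = M.countP P := by
  rw [mem_arrangements] at hL
  rw [← hL, Multiset.coe_countP]

end Multiset

/-! ### Insertion of the undecorated cells on and above the main diagonal. -/

section Sums

variable {A : Type*} [CommRing A] (q : A)

/-- The generating function of the undecorated cells on and above the main diagonal. -/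
theorem sum_arrangements_high (M : Multiset Cell) (hM : ∀ u ∈ M, u.2.2 = false ∧ 0 ≤ u.1) :
    ∑ l ∈ arrangements M, chainWeight q Follows Attacks startCell startCell l =
      ∏ v ∈ M.toFinset, qBinom q (M.countP (fun u => Attacks v u) +
        (if Attacks v startCell then 1 else 0) + M.count v - 1) (M.count v) := by
  generalize hS : M.toFinset = S
  -- Here `startCell` is also the end marker. It may come after every cell considered and after
  -- itself, so the empty word has weight `1`. By contrast, `stopCell` cannot follow `startCell`,
  -- which would spoil both the base case and the condition `htrans` of `sum_shuffles_repeated`.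
  induction S using Finset.induction_on_max_value Cell.key generalizing M with
  | empty =>
    rw [Multiset.toFinset_eq_empty] at hS
    subst hS
    have h0 : arrangements (0 : Multiset Cell) = {[]} := by ext l; simp
    have : Follows startCell startCell := (follows_of_unmarked rfl).2 (Or.inl le_rfl)
    simp [h0, chainWeight, invCount, this]
  | insert k S hkS hmax ih =>
    have hkM : k ∈ M := by rw [← Multiset.mem_toFinset, hS]; simp
    have hkM' : k ∉ M.filter (fun x => x ≠ k) := by simp
    have hS' := toFinset_filter_ne hkS hS
    have hk := hM k hkM
    have hlt : ∀ u ∈ M.filter (fun x => x ≠ k), u.2.2 = false ∧ 0 ≤ u.1 ∧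
        (u.1 < k.1 ∨ (u.1 = k.1 ∧ k.2.1 < u.2.1)) := by
      intro u hu
      have h1 := hmax u (by rw [← hS']; simpa using hu)
      rw [Cell.key_le_key] at h1
      rw [Multiset.mem_filter, ne_eq, Cell.ext_iff'] at hu
      have h2 := hM u hu.1
      refine ⟨h2.1, h2.2, ?_⟩
      have := hu.2
      simp only [h2.1, hk.1, and_true] at this
      omega
    have h3 : ∀ v ∈ S, v.2.2 = false ∧ ¬ Attacks v k ∧ v ≠ k := by
      intro v hv
      have h1 := hlt v (by rw [← Multiset.mem_toFinset, hS']; exact hv)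
      refine ⟨h1.1, ?_, fun h => hkS (h ▸ hv)⟩
      unfold Attacks
      omega
    conv_lhs => rw [← filter_ne_add_replicate M k]
    rw [sum_arrangements_add_replicate hkM', Finset.prod_insert hkS]
    have step : ∀ L ∈ arrangements (M.filter (fun x => x ≠ k)),
        ((shuffles k L (M.count k)).map (chainWeight q Follows Attacks startCell startCell)).sum =
          chainWeight q Follows Attacks startCell startCell L *
          qBinom q (M.countP (fun u => Attacks k u) +
            (if Attacks k startCell then 1 else 0) + M.count k - 1) (M.count k) := by
      intro L hL
      have hL' : ∀ u ∈ L, u.2.2 = false ∧ 0 ≤ u.1 ∧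
          (u.1 < k.1 ∨ (u.1 = k.1 ∧ k.2.1 < u.2.1)) := by
        intro u hu
        rw [mem_arrangements] at hL
        exact hlt u (by rw [← hL]; exact hu)
      have hL'' : ∀ u ∈ startCell :: L, u.2.2 = false ∧
          (u.1 < k.1 ∨ (u.1 = k.1 ∧ k.2.1 < u.2.1)) := by
        intro u hu
        rcases List.mem_cons.1 hu with rfl | hu
        · simp only [startCell, true_and]; omega
        · exact ⟨(hL' u hu).1, (hL' u hu).2.2⟩
      -- The insertion order makes this work: the cells present are on lower diagonals, or on the
      -- diagonal of `k` with larger labels. Both relations select the latter and the cells one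
      -- diagonal below with a smaller label.
      have e : ∀ u ∈ startCell :: L, (Attacks k u ↔ Follows u k) := by
        intro u hu
        have := hL'' u hu
        rw [attacks_of_unmarked hk.1, follows_of_unmarked hk.1]
        omega
      rw [sum_shuffles_repeated q (M.count k)]
      · have e1 : L.countP (fun u => Follows u k) = L.countP (fun u => Attacks k u) :=
          List.countP_congr fun u hu => by simpa using (e u (by simp [hu])).symm
        rw [e1, countP_eq_of_mem_arrangements hL, countP_filter_ne]
        · simp only [e startCell (by simp)]
        · unfold Attacks; omega
      · intro h; have := hL' k h; omega
      · simp [Follows, hk.1]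
      · intro u hu; have := hL'' u hu; rw [follows_of_unmarked this.1]; omega
      · intro p hp u hu
        have h1 := hL'' p hp
        have h2 := hL'' u hu
        rw [follows_of_unmarked hk.1, follows_of_unmarked h2.1]
        omega
      · unfold Attacks; omega
      · intro u hu; have := hL'' u (by simp [hu]); unfold Attacks; omega
      · intro u hu; exact e u (by simp [hu])
    rw [Finset.sum_congr rfl step, ← Finset.sum_mul, ih _ _ hS', mul_comm]
    · congr 1
      refine Finset.prod_congr rfl fun v hv => ?_
      rw [countP_filter_ne (h3 v hv).2.1, count_filter_ne (h3 v hv).2.2]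
    · intro u hu; exact hM u (Multiset.mem_of_mem_filter hu)

end Sums

/-! ### Reading words backwards. -/

section Reverse

variable {α : Type*} {A : Type*} [CommRing A] (q : A) (R att : α → α → Prop) [DecidableRel R]
  [DecidableRel att]

theorem invCount_append_singleton (l : List α) (x : α) :
    invCount att (l ++ [x]) = invCount att l + l.countP (fun u => att u x) := by
  induction l with
  | nil => simp [invCount]
  | cons y l ih =>
    simp only [List.cons_append, invCount, ih, List.countP_append, List.countP_cons,
      List.countP_nil]
    omega

theorem invCount_reverse (l : List α) :
    invCount (fun a b => att b a) l.reverse = invCount att l := by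
  induction l with
  | nil => rfl
  | cons x l ih =>
    rw [List.reverse_cons, invCount_append_singleton, ih, List.countP_reverse, invCount, add_comm]

theorem chainWeight_reverse (p e : α) (l : List α) :
    chainWeight q (fun a b => R b a) (fun a b => att b a) e p l.reverse =
      chainWeight q R att p e l := by
  have h : e :: (l.reverse ++ [p]) = (p :: (l ++ [e])).reverse := by simp
  simp only [chainWeight, invCount_reverse, h, List.isChain_reverse]

theorem sum_arrangements_reverse [DecidableEq α] (M : Multiset α) (p e : α) :
    ∑ l ∈ arrangements M, chainWeight q R att p e l =
      ∑ l ∈ arrangements M, chainWeight q (fun a b => R b a) (fun a b => att b a) e p l :=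
  Finset.sum_nbij' List.reverse List.reverse (by simp) (by simp) (by simp) (by simp)
    (fun l _ => (chainWeight_reverse q R att p e l).symm)

end Reverse

/-! ### Insertion of the undecorated cells below the main diagonal, then of the decorated cells. -/

section Sums

variable {A : Type*} [CommRing A] (q : A)

/-- Adding the undecorated cells below the main diagonal. -/
theorem sum_arrangements_low (N : ℕ) (H W : Multiset Cell)
    (hH : ∀ u ∈ H, u.2.2 = false ∧ 0 ≤ u.1) (hW : ∀ u ∈ W, u.2.2 = false ∧ u.1 < 0) :
    ∑ l ∈ arrangements (H + W), chainWeight q Follows Attacks startCell (stopCell N) l =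
      (∑ l ∈ arrangements H, chainWeight q Follows Attacks startCell (stopCell N) l) *
      ∏ v ∈ W.toFinset, qBinom q ((H + W).countP (fun u => Attacks u v) + W.count v - 1)
        (W.count v) := by
  generalize hS : W.toFinset = S
  induction S using Finset.induction_on_min_value Cell.key generalizing W with
  | empty =>
    rw [Multiset.toFinset_eq_empty] at hS
    simp [hS]
  | insert k S hkS hmin ih =>
    have hkW : k ∈ W := by rw [← Multiset.mem_toFinset, hS]; simp
    have hS' := toFinset_filter_ne hkS hS
    have hk := hW k hkW
    have hkM' : k ∉ H + W.filter (fun x => x ≠ k) := by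
      have : k ∉ H := fun h => by have := hH k h; omega
      simp [this]
    have hlt : ∀ u ∈ H + W.filter (fun x => x ≠ k), u.2.2 = false ∧
        (k.1 < u.1 ∨ (u.1 = k.1 ∧ u.2.1 < k.2.1)) := by
      intro u hu
      rcases Multiset.mem_add.1 hu with hu | hu
      · have := hH u hu
        exact ⟨this.1, Or.inl (by omega)⟩
      have h1 := hmin u (by rw [← hS']; simpa using hu)
      rw [Cell.key_le_key] at h1
      rw [Multiset.mem_filter, ne_eq, Cell.ext_iff'] at hu
      have h2 := hW u hu.1
      refine ⟨h2.1, ?_⟩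
      have := hu.2
      simp only [h2.1, hk.1, and_true] at this
      omega
    have h3 : ∀ v ∈ S, v.2.2 = false ∧ ¬ Attacks k v ∧ v ≠ k := by
      intro v hv
      have h1 := hlt v (Multiset.mem_add.2 (Or.inr (by rwa [← Multiset.mem_toFinset, hS'])))
      refine ⟨h1.1, ?_, fun h => hkS (h ▸ hv)⟩
      rw [attacks_of_unmarked hk.1]
      omega
    have hfilter : H + W = (H + W.filter (fun x => x ≠ k)) + Multiset.replicate (W.count k) k := by
      rw [add_assoc, filter_ne_add_replicate]
    have hcount : ∀ v, ¬ Attacks k v → (H + W.filter (fun x => x ≠ k)).countP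
        (fun u => Attacks u v) = (H + W).countP (fun u => Attacks u v) := by
      intro v hv
      rw [Multiset.countP_add, Multiset.countP_add, countP_filter_ne (P := fun u => Attacks u v) hv]
    have hkk : ¬ Attacks k k := by rw [attacks_of_unmarked hk.1]; omega
    conv_lhs => rw [hfilter]
    -- The cell `k` may come after every cell present, whereas `sum_shuffles_repeated` asks for a
    -- letter that may come before all others. Hence words are read backwards, with `stopCell` in
    -- front.
    rw [sum_arrangements_reverse, sum_arrangements_add_replicate hkM', Finset.prod_insert hkS]
    have step : ∀ L ∈ arrangements (H + W.filter (fun x => x ≠ k)),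
        ((shuffles k L (W.count k)).map (chainWeight q (fun a b => Follows b a)
          (fun a b => Attacks b a) (stopCell N) startCell)).sum =
          chainWeight q (fun a b => Follows b a)
          (fun a b => Attacks b a) (stopCell N) startCell L *
          qBinom q ((H + W).countP (fun u => Attacks u k) + W.count k - 1) (W.count k) := by
      intro L hL
      have hL' : ∀ u ∈ L, u.2.2 = false ∧
          (k.1 < u.1 ∨ (u.1 = k.1 ∧ u.2.1 < k.2.1)) := by
        intro u hu
        rw [mem_arrangements] at hL
        exact hlt u (by rw [← hL]; exact hu)
      have hL'' : ∀ u ∈ startCell :: L, u.2.2 = false ∧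
          (k.1 < u.1 ∨ (u.1 = k.1 ∧ u.2.1 ≤ k.2.1)) := by
        intro u hu
        rcases List.mem_cons.1 hu with rfl | hu
        · simp only [startCell, true_and]; omega
        · have := hL' u hu; exact ⟨this.1, by omega⟩
      have e : ∀ u ∈ L, (Attacks u k ↔ Follows k u) := by
        intro u hu
        have := hL' u hu
        rw [attacks_of_unmarked this.1, follows_of_unmarked this.1]
        omega
      -- A cell below the main diagonal cannot be the last one, so the end of the path is not a site
      -- and the number of sites is just the number of attackers of `k`.
      have hlast : ¬ Follows k (stopCell N) := by
        rw [follows_of_unmarked rfl]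
        simp only [stopCell]
        omega
      rw [sum_shuffles_repeated q (W.count k)]
      · have e1 : L.countP (fun u => Follows k u) = L.countP (fun u => Attacks u k) :=
          List.countP_congr fun u hu => by simpa using (e u hu).symm
        rw [e1, countP_eq_of_mem_arrangements hL, hcount _ hkk, if_neg hlast, add_zero]
      · intro h; have := hL' k h; omega
      · exact (follows_of_unmarked hk.1).2 (by omega)
      · intro u hu; have := hL'' u hu; rw [follows_of_unmarked hk.1]; omega
      · intro p hp u hu h
        rcases List.mem_cons.1 hp with rfl | hp
        · exact absurd h hlast
        · have h1 := hL' p hp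
          have h2 := hL'' u hu
          rw [follows_of_unmarked h1.1] at h ⊢
          omega
      · exact hkk
      · intro u hu; have := hL' u hu; rw [attacks_of_unmarked hk.1]; omega
      · exact e
    rw [Finset.sum_congr rfl step, ← Finset.sum_mul, ← sum_arrangements_reverse, ih _ _ hS',
      mul_assoc, mul_comm (Finset.prod _ _)]
    · congr 2
      refine Finset.prod_congr rfl fun v hv => ?_
      rw [hcount v (h3 v hv).2.1, count_filter_ne (h3 v hv).2.2]
    · intro u hu; exact hW u (Multiset.mem_of_mem_filter hu)

/-- Adding the decorated cells. -/
theorem sum_arrangements_marked (N : ℕ) (U D : Multiset Cell)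
    (hU : ∀ u ∈ U, u.2.2 = false) (hD : ∀ u ∈ D, u.2.2 = true ∧ u.2.1 < N) :
    ∑ l ∈ arrangements (U + D), chainWeight q Follows Attacks startCell (stopCell N) l =
      (∑ l ∈ arrangements U, chainWeight q Follows Attacks startCell (stopCell N) l) *
      ∏ v ∈ D.toFinset, (q ^ ((if Follows startCell v then 0 else D.count v) +
        (D.count v).choose 2) *
        qBinom q (U.countP (fun u => Attacks u v) - if v.1 = -1 ∧ v.2.1 = 0 then 1 else 0)
        (D.count v)) := by
  generalize hS : D.toFinset = S
  induction S using Finset.induction_on_max_value Cell.key generalizing D with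
  | empty =>
    rw [Multiset.toFinset_eq_empty] at hS
    simp [hS]
  | insert k S hkS hmax ih =>
    have hkD : k ∈ D := by rw [← Multiset.mem_toFinset, hS]; simp
    have hS' := toFinset_filter_ne hkS hS
    have hk := hD k hkD
    have hkM' : k ∉ U + D.filter (fun x => x ≠ k) := by
      have : k ∉ U := fun h => by simpa [hk.1] using hU k h
      simp [this]
    have hlt : ∀ u ∈ D.filter (fun x => x ≠ k), u.2.2 = true ∧
        (u.1 < k.1 ∨ (u.1 = k.1 ∧ k.2.1 < u.2.1)) := by
      intro u hu
      have h1 := hmax u (by rw [← hS']; simpa using hu)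
      rw [Cell.key_le_key] at h1
      rw [Multiset.mem_filter, ne_eq, Cell.ext_iff'] at hu
      have h2 := hD u hu.1
      refine ⟨h2.1, ?_⟩
      have := hu.2
      simp only [h2.1, hk.1, and_true] at this
      omega
    have hfilter : U + D = (U + D.filter (fun x => x ≠ k)) + Multiset.replicate (D.count k) k := by
      rw [add_assoc, filter_ne_add_replicate]
    conv_lhs => rw [hfilter]
    rw [sum_arrangements_add_replicate hkM', Finset.prod_insert hkS]
    have step : ∀ L ∈ arrangements (U + D.filter (fun x => x ≠ k)),
        ((shuffles k L (D.count k)).map (chainWeight q Follows Attacks startCell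
          (stopCell N))).sum =
          chainWeight q Follows Attacks startCell (stopCell N) L *
          (q ^ ((if Follows startCell k then 0 else D.count k) + (D.count k).choose 2) *
            qBinom q (U.countP (fun u => Attacks u k) - if k.1 = -1 ∧ k.2.1 = 0 then 1 else 0)
            (D.count k)) := by
      intro L hL
      have hL' : ∀ u ∈ L, u.2.2 = false ∨ (u.2.2 = true ∧
          (u.1 < k.1 ∨ (u.1 = k.1 ∧ k.2.1 < u.2.1))) := by
        intro u hu
        rw [mem_arrangements] at hL
        have : u ∈ U + D.filter (fun x => x ≠ k) := by rw [← hL]; exact hu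
        rcases Multiset.mem_add.1 this with h | h
        · exact Or.inl (hU u h)
        · exact Or.inr (hlt u h)
      have hs : ∀ u ∈ startCell :: L, u.2.2 = false ∨ (u.2.2 = true ∧
          (u.1 < k.1 ∨ (u.1 = k.1 ∧ k.2.1 < u.2.1))) := by
        intro u hu
        rcases List.mem_cons.1 hu with rfl | hu
        · exact Or.inl rfl
        · exact hL' u hu
      have ht : ∀ u ∈ stopCell N :: L, u.2.2 = false ∨ (u.2.2 = true ∧
          (u.1 < k.1 ∨ (u.1 = k.1 ∧ k.2.1 < u.2.1))) := by
        intro u hu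
        rcases List.mem_cons.1 hu with rfl | hu
        · exact Or.inl rfl
        · exact hL' u hu
      have hfk : ∀ u, Follows u k ↔ k.1 < u.1 ∨ (k.1 = u.1 ∧ u.2.1 < k.2.1) :=
        fun u => follows_of_marked hk.1
      have htotal : ∀ u ∈ startCell :: L, Follows u k ∨ Follows k u := by
        intro u hu
        rw [hfk]
        rcases hs u hu with h | ⟨h, h'⟩
        · rw [follows_of_unmarked h]; omega
        · rw [follows_of_marked h]; omega
      have hsplit : ∀ p ∈ startCell :: L, ∀ u ∈ stopCell N :: L, Follows p u →
          Follows p k ∨ Follows k u := by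
        intro p _ u hu
        rw [hfk]
        rcases ht u hu with h | ⟨h, h'⟩
        · rw [follows_of_unmarked h, follows_of_unmarked h]; omega
        · rw [follows_of_marked h, follows_of_marked h]; omega
      have e : ∀ u ∈ L, (Attacks u k ↔ Follows u k ∧ Follows k u) := by
        intro u hu
        rw [hfk]
        rcases hL' u hu with h | ⟨h, h'⟩
        · rw [attacks_of_unmarked h, follows_of_unmarked h]; omega
        · rw [follows_of_marked h, iff_false_intro (not_attacks_of_marked h), false_iff]; omega
      rw [sum_shuffles_distinct q (D.count k)]
      -- If `L` is not a chain, both sides vanish. For a chain, `slots_add` corrects the number of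
      -- attackers by the two ends of the word; the corrections cancel except for label `0` on the
      -- diagonal just below the main one. In that case it also shows that there is an attacker, so
      -- the truncated subtraction is exact.
      · by_cases hchain : List.IsChain Follows (startCell :: (L ++ [stopCell N]))
        · have hsl := slots_add htotal hsplit hchain
          have e1 : L.countP (fun u => Follows u k ∧ Follows k u) =
              U.countP (fun u => Attacks u k) := by
            rw [List.countP_congr (q := fun u => Attacks u k)
              (fun u hu => by simpa using (e u hu).symm), countP_eq_of_mem_arrangements hL,
              Multiset.countP_add, Nat.add_eq_left, Multiset.countP_eq_zero]
            intro u hu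
            exact not_attacks_of_marked (hlt u hu).1
          have e2 : slots Follows k (stopCell N) startCell L = U.countP (fun u => Attacks u k) -
              if k.1 = -1 ∧ k.2.1 = 0 then 1 else 0 := by
            rw [e1] at hsl
            have hstart : Follows startCell k ↔ k.1 < -1 ∨ (k.1 = -1 ∧ 0 < k.2.1) := hfk _
            have hlast : Follows k (stopCell N) ↔ 0 ≤ k.1 := by
              rw [follows_of_unmarked rfl]
              simp only [stopCell]
              omega
            simp only [hstart, hlast] at hsl
            split_ifs at hsl ⊢ <;> omega
          rw [e2]
        · simp [chainWeight, hchain]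
      · intro h
        rcases hL' k h with h | h
        · simp [hk.1] at h
        · omega
      · rw [hfk]; omega
      · exact htotal
      · intro p _ u hu
        rw [hfk]
        rcases ht u hu with h | ⟨h, h'⟩
        · rw [follows_of_unmarked h, follows_of_unmarked h]; omega
        · rw [follows_of_marked h, follows_of_marked h]; omega
      · exact hsplit
      · exact not_attacks_of_marked hk.1
      · intro u _; exact not_attacks_of_marked hk.1
      · exact e
    rw [Finset.sum_congr rfl step, ← Finset.sum_mul, ih _ _ hS', mul_assoc,
      mul_comm (Finset.prod _ _)]
    · congr 2
      refine Finset.prod_congr rfl fun v hv => ?_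
      rw [count_filter_ne (by rintro rfl; exact hkS hv)]
    · intro u hu; exact hD u (Multiset.mem_of_mem_filter hu)

end Sums

/-! ### Multisets of cells given by their diagonals. -/

section Cells

/-- The cells with the labels `f i` on the `i`-th diagonal, for `i ∈ I`, when the main diagonal has
number `s`. -/
def cells (s : ℕ) (m : Bool) (f : ℕ → List ℕ) (I : Finset ℕ) : Multiset Cell :=
  ∑ i ∈ I, (f i : Multiset ℕ).map fun c => ((i : ℤ) - s, c, m)

variable {s : ℕ} {m : Bool} {f : ℕ → List ℕ} {I : Finset ℕ}

theorem mem_cells {v : Cell} :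
    v ∈ cells s m f I ↔ ∃ i ∈ I, ∃ c ∈ f i, ((i : ℤ) - s, c, m) = v := by
  simp [cells, Multiset.mem_sum]

theorem countP_cells (P : Cell → Prop) [DecidablePred P] :
    (cells s m f I).countP P = ∑ i ∈ I, (f i).countP (fun c => P ((i : ℤ) - s, c, m)) := by
  rw [cells, ← Multiset.coe_countPAddMonoidHom, map_sum]
  refine Finset.sum_congr rfl fun i _ => ?_
  rw [Multiset.coe_countPAddMonoidHom, Multiset.countP_map, ← Multiset.countP_eq_card_filter,
    Multiset.coe_countP]

theorem card_cells : (cells s m f I).card = ∑ i ∈ I, (f i).length := by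
  simp [cells, Multiset.card_sum]

theorem count_cells {i c : ℕ} (hi : i ∈ I) :
    (cells s m f I).count ((i : ℤ) - s, c, m) = (f i).count c := by
  rw [Multiset.count, countP_cells, Finset.sum_eq_single_of_mem i hi]
  · rw [List.count]
    refine List.countP_congr fun d _ => ?_
    simp only [beq_iff_eq, Prod.mk.injEq, true_and, and_true, decide_eq_true_eq]
    exact eq_comm
  · intro j _ hj
    rw [List.countP_eq_zero]
    intro d _
    simp only [Prod.mk.injEq, decide_eq_true_eq]
    omega

theorem countP_attacks_left (hf : ∀ i ∉ I, f i = []) (i c : ℕ) (m' : Bool) :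
    (cells s false f I).countP (fun u => Attacks u ((i : ℤ) - s, c, m')) =
      (f i).countP (fun d => d < c) + (f (i + 1)).countP (fun d => c < d) := by
  rw [countP_cells]
  have h : ∀ j ∈ I, (f j).countP (fun d => Attacks ((j : ℤ) - s, d, false) ((i : ℤ) - s, c, m')) =
      (if j = i then (f i).countP (fun d => d < c) else 0) +
        (if j = i + 1 then (f (i + 1)).countP (fun d => c < d) else 0) := by
    intro j _
    simp only [attacks_of_unmarked]
    split_ifs with h1 h2 h2
    · omega
    · subst h1
      simp
    · subst h2
      rw [zero_add]
      refine List.countP_congr fun d _ => ?_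
      simp only [decide_eq_true_eq]
      omega
    · rw [List.countP_eq_zero]
      intro d _
      simp only [decide_eq_true_eq]
      omega
  rw [Finset.sum_congr rfl h, Finset.sum_add_distrib, Finset.sum_ite_eq', Finset.sum_ite_eq']
  congr 1
  · split_ifs with h
    · rfl
    · simp [hf _ h]
  · split_ifs with h
    · rfl
    · simp [hf _ h]

theorem countP_attacks_right (i c : ℕ) :
    (cells s false f I).countP (fun u => Attacks ((i : ℤ) - s, c, false) u) =
      (if i ∈ I then (f i).countP (fun d => c < d) else 0) +
        (if 0 < i ∧ i - 1 ∈ I then (f (i - 1)).countP (fun d => d < c) else 0) := by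
  rw [countP_cells]
  have h : ∀ j ∈ I, (f j).countP (fun d => Attacks ((i : ℤ) - s, c, false) ((j : ℤ) - s, d, false)) =
      (if j = i then (f i).countP (fun d => c < d) else 0) +
        (if j = i - 1 then (if 0 < i then (f (i - 1)).countP (fun d => d < c) else 0) else 0) := by
    intro j _
    simp only [attacks_of_unmarked]
    split_ifs with h1 h2 h2 h2 h3
    · omega
    · subst h1
      simp
    · subst h1
      simp
    · subst h2
      rw [zero_add]
      refine List.countP_congr fun d _ => ?_
      simp only [decide_eq_true_eq]
      omega
    · omega
    · rw [List.countP_eq_zero]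
      intro d _
      simp only [decide_eq_true_eq]
      omega
  rw [Finset.sum_congr rfl h, Finset.sum_add_distrib, Finset.sum_ite_eq', Finset.sum_ite_eq']
  congr 1
  split_ifs <;> tauto

/-- Absent cells contribute the factor `1`, so a product over the cells present may be taken over
all diagonals and all labels below `N`, as in the schedule formula. -/
theorem prod_toFinset_cells {A : Type*} [CommMonoid A] (N : ℕ) (hN : ∀ i ∈ I, ∀ c ∈ f i, c < N)
    (g : Cell → A) (hg : ∀ v, (cells s m f I).count v = 0 → g v = 1) :
    ∏ v ∈ (cells s m f I).toFinset, g v =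
      ∏ i ∈ I, ∏ c ∈ Finset.range N, g ((i : ℤ) - s, c, m) := by
  rw [← Finset.prod_product']
  have hinj : Set.InjOn (fun p : ℕ × ℕ => (((p.1 : ℤ) - s, p.2, m) : Cell))
      (I ×ˢ Finset.range N : Finset (ℕ × ℕ)) := by
    rintro ⟨i, c⟩ _ ⟨j, d⟩ _ h
    simp only [Prod.mk.injEq] at h ⊢
    omega
  rw [← Finset.prod_image (g := fun p : ℕ × ℕ => (((p.1 : ℤ) - s, p.2, m) : Cell)) hinj]
  refine Finset.prod_subset ?_ ?_
  · intro v hv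
    rw [Multiset.mem_toFinset, mem_cells] at hv
    obtain ⟨i, hi, c, hc, rfl⟩ := hv
    exact Finset.mem_image.2 ⟨(i, c), by simp [hi, hN i hi c hc], rfl⟩
  · intro v _ hv
    rw [Multiset.mem_toFinset] at hv
    exact hg v (Multiset.count_eq_zero.2 hv)

end Cells

theorem sum_ite_count {α : Type*} [DecidableEq α] (D : Multiset α) (P : α → Prop)
    [DecidablePred P] :
    ∑ v ∈ D.toFinset, (if P v then 0 else D.count v) = D.countP (fun v => ¬ P v) := by
  rw [Multiset.countP_eq_card_filter,
    ← Multiset.sum_count_eq_card (s := D.toFinset) (m := D.filter fun v => ¬ P v)]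
  · refine Finset.sum_congr rfl fun v _ => ?_
    rw [Multiset.count_filter]
    split_ifs <;> tauto
  · intro a ha
    simpa using (Multiset.mem_filter.1 ha).1

/-! ### From insertion factors to schedule numbers. -/

section Runs

variable {A : Type*} [CommRing A] (q : A) (z : MarkedWord) (s : ℕ)

theorem run_eq_nil {i : ℕ} (hi : (runs z).length ≤ i) : run z i = [] := by
  rw [run, List.getD_eq_default]
  simpa using hi

theorem unmarkedRun_eq_nil {i : ℕ} (hi : (runs z).length ≤ i) : unmarkedRun z i = [] := by
  simp [unmarkedRun, run_eq_nil z hi]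

theorem markedRun_eq_nil {i : ℕ} (hi : (runs z).length ≤ i) : markedRun z i = [] := by
  simp [markedRun, run_eq_nil z hi]

/-- The factor of the schedule formula that belongs to the undecorated labels `c` on the `i`-th
diagonal. -/
def unmarkedFactor (i c : ℕ) : A := qBinom q (schedule z s i c + mult z i c - 1) (mult z i c)

/-- The `q`-binomial that belongs to the decorated labels `c` on the `i`-th diagonal. -/
def markedFactor (i c : ℕ) : A := qBinom q (markedSchedule z s i c) (markedMult z i c)

/-- The undecorated cells of a word. -/
def unmarkedCells : Multiset Cell := cells s false (unmarkedRun z) (Finset.range (runs z).length)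

/-- The decorated cells of a word. -/
def markedCells : Multiset Cell := cells s true (markedRun z) (Finset.range (runs z).length)

variable {z s}

theorem sum_high_start (N : ℕ) (hN : ∀ i, ∀ c ∈ unmarkedRun z i, c < N) :
    ∑ l ∈ arrangements (cells s false (unmarkedRun z)
        ((Finset.range (runs z).length).filter (fun i => ¬ i < s))),
      chainWeight q Follows Attacks startCell startCell l =
      ∏ i ∈ (Finset.range (runs z).length).filter (fun i => ¬ i < s), ∏ c ∈ Finset.range N,
        unmarkedFactor q z s i c := by
  rw [sum_arrangements_high, prod_toFinset_cells N (fun i _ => hN i)]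
  · refine Finset.prod_congr rfl fun i hi => Finset.prod_congr rfl fun c _ => ?_
    rw [count_cells hi, countP_attacks_right, unmarkedFactor, if_pos hi, mult]
    congr 3
    rw [Finset.mem_filter, Finset.mem_range] at hi
    -- The start of the path is a site only for positive labels on the main diagonal; this is the
    -- summand `1 - δ_{c,0}` of the schedule number for `i = s`.
    have h2 : Attacks ((i : ℤ) - s, c, false) startCell ↔ i = s ∧ 0 < c := by
      rw [attacks_of_unmarked rfl]
      simp only [startCell]
      omega
    simp only [h2, schedule, Finset.mem_filter, Finset.mem_range]
    split_ifs <;> omega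
  · intro v hv
    rw [hv, qBinom_zero_right]
  · intro u hu
    obtain ⟨i, hi, c, -, rfl⟩ := mem_cells.1 hu
    rw [Finset.mem_filter] at hi
    exact ⟨rfl, by simp only; omega⟩

/-- Both end markers may come after every cell of `l`, so neither imposes a condition. Nonemptiness
is essential, because `startCell` may follow itself but `stopCell` may not follow it. -/
theorem chainWeight_stopCell (N : ℕ) {l : List Cell} (hl : l ≠ [])
    (h : ∀ u ∈ l, 0 ≤ u.1 ∧ u.2.1 < N) :
    chainWeight q Follows Attacks startCell (stopCell N) l =
      chainWeight q Follows Attacks startCell startCell l := by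
  have h1 : ∀ u ∈ l, Follows u (stopCell N) ∧ Follows u startCell := by
    intro u hu
    have := h u hu
    rw [follows_of_unmarked rfl, follows_of_unmarked rfl]
    simp only [startCell, stopCell]
    omega
  have h2 : ∀ e : Cell, (∀ u ∈ l, Follows u e) →
      (List.IsChain Follows (startCell :: (l ++ [e])) ↔ List.IsChain Follows (startCell :: l)) := by
    intro e he
    rw [← List.cons_append, List.isChain_append]
    simp only [List.IsChain.singleton, true_and, List.head?_cons, Option.mem_some_iff,
      forall_eq', and_iff_left_iff_imp]
    intro _ u hu
    have hu := List.mem_of_mem_getLast? hu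
    refine he u ?_
    rename_i hu'
    rw [List.getLast?_cons_of_ne_nil hl] at hu'
    exact List.mem_of_mem_getLast? hu'
  simp only [chainWeight, h2 _ (fun u hu => (h1 u hu).1), h2 _ (fun u hu => (h1 u hu).2)]

/-- Without undecorated cells on or above the main diagonal, the insertion of the low cells starts
from the empty word, whose weight with `stopCell` is `0`; this is the indicator. Otherwise the end
marker can be exchanged and `sum_high_start` applies. -/
theorem sum_unmarked [Decidable (∀ i, ¬ i < s → unmarkedRun z i = [])] (N : ℕ)
    (hN : ∀ i, ∀ c ∈ unmarkedRun z i, c < N) :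
    ∑ l ∈ arrangements (unmarkedCells z s),
      chainWeight q Follows Attacks startCell (stopCell N) l =
      (if ∀ i, ¬ i < s → unmarkedRun z i = [] then 0 else 1) *
      ∏ i ∈ Finset.range (runs z).length, ∏ c ∈ Finset.range N, unmarkedFactor q z s i c := by
  have hsplit : unmarkedCells z s =
      cells s false (unmarkedRun z) ((Finset.range (runs z).length).filter (fun i => ¬ i < s)) +
      cells s false (unmarkedRun z) ((Finset.range (runs z).length).filter (fun i => i < s)) := by
    rw [add_comm, unmarkedCells, cells, cells, cells]
    exact (Finset.sum_filter_add_sum_filter_not _ _ _).symm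
  rw [hsplit, sum_arrangements_low, ← hsplit, prod_toFinset_cells N (fun i _ => hN i)]
  · have h1 : ∀ i ∈ (Finset.range (runs z).length).filter (fun i => i < s),
        ∀ c, qBinom q ((unmarkedCells z s).countP (fun u => Attacks u ((i : ℤ) - s, c, false)) +
          (cells s false (unmarkedRun z)
            ((Finset.range (runs z).length).filter (fun i => i < s))).count
              ((i : ℤ) - s, c, false) - 1) ((cells s false (unmarkedRun z)
            ((Finset.range (runs z).length).filter (fun i => i < s))).count
              ((i : ℤ) - s, c, false)) = unmarkedFactor q z s i c := by
      intro i hi c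
      rw [count_cells hi, unmarkedCells, countP_attacks_left
        (fun i hi => unmarkedRun_eq_nil z (by simpa using hi)), unmarkedFactor, mult]
      rw [Finset.mem_filter] at hi
      rw [schedule, if_neg (by omega), if_neg (by omega)]
    rw [Finset.prod_congr rfl fun i hi => Finset.prod_congr rfl fun c _ => h1 i hi c]
    rw [← Finset.prod_filter_mul_prod_filter_not (Finset.range (runs z).length) (fun i => i < s),
      ← sum_high_start q N hN]
    rw [← mul_assoc, mul_right_comm]
    congr 1
    split_ifs with h0
    · have : cells s false (unmarkedRun z)
        ((Finset.range (runs z).length).filter (fun i => ¬ i < s)) = 0 := by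
        rw [cells]
        refine Finset.sum_eq_zero fun i hi => ?_
        rw [h0 i (Finset.mem_filter.1 hi).2]
        rfl
      rw [this]
      have h0 : arrangements (0 : Multiset Cell) = {[]} := by ext l; simp
      have h2 : ¬ Follows startCell (stopCell N) := by
        rw [follows_of_unmarked rfl]; simp [startCell, stopCell]
      simp [h0, chainWeight, h2]
    · rw [one_mul]
      refine Finset.sum_congr rfl fun l hl => ?_
      rw [mem_arrangements] at hl
      refine chainWeight_stopCell q N ?_ ?_
      · rintro rfl
        push Not at h0
        obtain ⟨i, hi, h⟩ := h0
        obtain ⟨c, hc⟩ := List.exists_mem_of_ne_nil _ h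
        have : ((i : ℤ) - s, c, false) ∈ cells s false (unmarkedRun z)
            ((Finset.range (runs z).length).filter (fun i => ¬ i < s)) := by
          refine mem_cells.2 ⟨i, ?_, c, hc, rfl⟩
          rw [Finset.mem_filter, Finset.mem_range]
          refine ⟨?_, by omega⟩
          by_contra hlt
          exact h (unmarkedRun_eq_nil z (by omega))
        rw [← hl] at this
        simp at this
      · intro u hu
        rw [← Multiset.mem_coe, hl] at hu
        obtain ⟨i, hi, c, hc, rfl⟩ := mem_cells.1 hu
        rw [Finset.mem_filter] at hi
        exact ⟨by simp only; omega, hN i c hc⟩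
  · intro v hv
    rw [hv, qBinom_zero_right]
  · intro u hu
    obtain ⟨i, hi, c, -, rfl⟩ := mem_cells.1 hu
    rw [Finset.mem_filter] at hi
    exact ⟨rfl, by simp only; omega⟩
  · intro u hu
    obtain ⟨i, hi, c, -, rfl⟩ := mem_cells.1 hu
    rw [Finset.mem_filter] at hi
    exact ⟨rfl, by simp only; omega⟩

/-- This makes the indicator in `sum_unmarked` superfluous. If the highest diagonal with unmarked
letters is below the main one, its smallest unmarked letter has schedule number `0` and positive
multiplicity. If there is no unmarked letter at all, every marked letter has schedule number `0`. -/
theorem exists_factor_eq_zero (N : ℕ) (hN : ∀ i, ∀ c ∈ unmarkedRun z i, c < N)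
    (hN' : ∀ i, ∀ c ∈ markedRun z i, c < N) (hz : ∃ i, run z i ≠ [])
    (h0 : ∀ i, ¬ i < s → unmarkedRun z i = []) :
    ∃ i ∈ Finset.range (runs z).length, ∃ c ∈ Finset.range N,
      unmarkedFactor q z s i c = 0 ∨ markedFactor q z s i c = 0 := by
  by_cases hu : ∃ i, unmarkedRun z i ≠ []
  · obtain ⟨j, hj⟩ := hu
    have hjs : j ≤ s := by
      by_contra h
      exact hj (h0 j (by omega))
    have hi := Nat.findGreatest_spec (P := fun i => unmarkedRun z i ≠ []) hjs hj
    set i := Nat.findGreatest (fun i => unmarkedRun z i ≠ []) s with hidef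
    have his : i < s := by
      by_contra h
      exact hi (h0 i h)
    have hi1 : unmarkedRun z (i + 1) = [] := by
      by_contra h
      exact Nat.findGreatest_is_greatest (P := fun i => unmarkedRun z i ≠ []) (n := s)
        (k := i + 1) (by omega) (by omega) h
    have hex : ∃ c, c ∈ unmarkedRun z i := List.exists_mem_of_ne_nil _ hi
    classical
    have hc := Nat.find_spec hex
    refine ⟨i, ?_, Nat.find hex, Finset.mem_range.2 (hN i _ hc), Or.inl ?_⟩
    · rw [Finset.mem_range]
      by_contra h
      exact hi (unmarkedRun_eq_nil z (by omega))
    · have hs : schedule z s i (Nat.find hex) = 0 := by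
        rw [schedule, if_neg (by omega), if_neg (by omega), hi1, List.countP_nil, add_zero,
          List.countP_eq_zero]
        intro d hd
        simp only [decide_eq_true_eq, not_lt]
        exact Nat.find_min' hex hd
      have hm : 0 < mult z i (Nat.find hex) := List.count_pos_iff.2 hc
      rw [unmarkedFactor, hs]
      exact qBinom_eq_zero_of_lt q (by omega)
  · push Not at hu
    obtain ⟨i, hi⟩ := hz
    obtain ⟨a, ha⟩ := List.exists_mem_of_ne_nil _ hi
    have hm : a.val ∈ markedRun z i := by
      refine List.mem_map.2 ⟨a, List.mem_filter.2 ⟨ha, ?_⟩, rfl⟩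
      by_contra h
      have : a.val ∈ unmarkedRun z i :=
        List.mem_map.2 ⟨a, List.mem_filter.2 ⟨ha, by simpa using h⟩, rfl⟩
      simp [hu i] at this
    refine ⟨i, ?_, a.val, Finset.mem_range.2 (hN' i _ hm), Or.inr ?_⟩
    · rw [Finset.mem_range]
      by_contra h
      exact hi (run_eq_nil z (by omega))
    · have : 0 < markedMult z i a.val := List.count_pos_iff.2 hm
      rw [markedFactor, markedSchedule, hu, hu]
      exact qBinom_eq_zero_of_lt q (by simpa using this)

/-- The generating function of the words of cells that correspond to paths, with respect to the
number of inversions. -/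
theorem sum_arrangements_cells (N : ℕ) (hN : ∀ i, ∀ c ∈ unmarkedRun z i, c < N)
    (hN' : ∀ i, ∀ c ∈ markedRun z i, c < N) (hz : ∃ i, run z i ≠ []) :
    ∑ l ∈ arrangements (unmarkedCells z s + markedCells z s),
      chainWeight q Follows Attacks startCell (stopCell N) l =
      q ^ (markedCells z s).countP (fun v => ¬ Follows startCell v) *
      ∏ i ∈ Finset.range (runs z).length, ∏ c ∈ Finset.range N,
        (unmarkedFactor q z s i c * q ^ (markedMult z i c).choose 2 *
          markedFactor q z s i c) := by
  have hD : ∏ v ∈ (markedCells z s).toFinset, (q ^ ((if Follows startCell v then 0 else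
        (markedCells z s).count v) + ((markedCells z s).count v).choose 2) *
        qBinom q ((unmarkedCells z s).countP (fun u => Attacks u v) -
          if v.1 = -1 ∧ v.2.1 = 0 then 1 else 0) ((markedCells z s).count v)) =
      q ^ (markedCells z s).countP (fun v => ¬ Follows startCell v) *
      ∏ i ∈ Finset.range (runs z).length, ∏ c ∈ Finset.range N,
        (q ^ (markedMult z i c).choose 2 * markedFactor q z s i c) := by
    simp only [pow_add, mul_assoc]
    rw [Finset.prod_mul_distrib, Finset.prod_pow_eq_pow_sum, sum_ite_count]
    congr 1
    rw [markedCells, prod_toFinset_cells N (fun i _ => hN' i)]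
    · refine Finset.prod_congr rfl fun i hi => Finset.prod_congr rfl fun c _ => ?_
      rw [count_cells hi, unmarkedCells, countP_attacks_left
        (fun i hi => unmarkedRun_eq_nil z (by simpa using hi)), markedMult, markedFactor,
        markedSchedule, markedMult]
      congr 4
      simp only [eq_iff_iff]
      omega
    · intro v hv
      simp [hv]
  classical
  rw [sum_arrangements_marked, hD, sum_unmarked q N hN]
  · simp only [mul_assoc, Finset.prod_mul_distrib]
    split_ifs with h0
    · obtain ⟨i, hi, c, hc, h⟩ := exists_factor_eq_zero q N hN hN' hz h0
      rcases h with h | h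
      · rw [Finset.prod_eq_zero (f := fun i => ∏ c ∈ Finset.range N, unmarkedFactor q z s i c) hi
          (Finset.prod_eq_zero hc h)]
        ring
      · rw [Finset.prod_eq_zero (f := fun i => ∏ c ∈ Finset.range N, markedFactor q z s i c) hi
          (Finset.prod_eq_zero hc h)]
        ring
    · ring
  · intro u hu
    obtain ⟨i, hi, c, -, rfl⟩ := mem_cells.1 hu
    rfl
  · intro u hu
    obtain ⟨i, hi, c, hc, rfl⟩ := mem_cells.1 hu
    exact ⟨rfl, hN' i c hc⟩

end Runs

/-! ### The exponent `b(z,s)`. -/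

section Bonus

variable (z : MarkedWord) (s : ℕ)

theorem cells_range_of_le {m : Bool} {f : ℕ → List ℕ} {n R : ℕ} (h : n ≤ R)
    (hf : ∀ i, n ≤ i → f i = []) :
    cells s m f (Finset.range n) = cells s m f (Finset.range R) := by
  refine Finset.sum_subset (by simpa using h) fun i _ hi => ?_
  rw [hf i (by simpa using hi)]
  rfl

theorem length_eq_count_zero_add (l : List ℕ) :
    l.length = l.count 0 + l.countP (fun c => 0 < c) := by
  rw [List.length_eq_countP_add_countP (p := fun c => c == 0), List.count]
  congr 1
  refine List.countP_congr fun c _ => ?_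
  simp [Nat.pos_iff_ne_zero]

/-- The identity holds diagonal by diagonal. For `i ≥ s` no decorated cell can start a path, so the
first and third terms cancel. For `i < s` the positive decorated labels cancel against the third
term, leaving the positive undecorated ones minus the decorated zeros; for `i = s - 1` these zeros
are restored by the first term, as they cannot start a path. -/
theorem bonus_eq :
    (((markedCells z s).countP (fun v => ¬ Follows startCell v) : ℕ) : ℤ) +
      ((unmarkedCells z s + markedCells z s).countP (fun u => u.1 < 0 ∧ 0 < u.2.1) : ℕ) -
      ((markedCells z s).card : ℤ) = bonus z s := by
  have hU : unmarkedCells z s =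
      cells s false (unmarkedRun z) (Finset.range ((runs z).length + s)) :=
    cells_range_of_le s (by omega) fun i hi => unmarkedRun_eq_nil z hi
  have hD : markedCells z s =
      cells s true (markedRun z) (Finset.range ((runs z).length + s)) :=
    cells_range_of_le s (by omega) fun i hi => markedRun_eq_nil z hi
  -- All sums are extended by zeros to a common range that contains every run and every `i < s`.
  have hR : s ≤ (runs z).length + s := by omega
  generalize (runs z).length + s = R at hU hD hR
  have hshift : ∑ i ∈ Finset.range s, (if i = 0 then 0 else (markedMult z (i - 1) 0 : ℤ)) =
      ∑ i ∈ Finset.range R, if i + 1 < s then (markedMult z i 0 : ℤ) else 0 := by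
    rw [← Finset.sum_filter]
    rcases s with _ | s
    · simp
    · rw [Finset.sum_range_succ']
      simp only [Nat.add_eq_zero_iff, one_ne_zero, and_false, if_false, Nat.add_sub_cancel,
        if_true, add_zero]
      refine Finset.sum_congr ?_ fun _ _ => rfl
      ext i
      simp only [Finset.mem_range, Finset.mem_filter]
      omega
  have hfirst : ∑ i ∈ Finset.range s, ((unmarkedRun z i).countP (fun d => 0 < d) : ℤ) =
      ∑ i ∈ Finset.range R, if i < s then ((unmarkedRun z i).countP (fun d => 0 < d) : ℤ)
        else 0 := by
    rw [← Finset.sum_filter]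
    refine Finset.sum_congr ?_ fun _ _ => rfl
    ext i
    simp only [Finset.mem_range, Finset.mem_filter]
    omega
  rw [bonus, Finset.sum_sub_distrib, hshift, hfirst, hU, hD, Multiset.countP_add, countP_cells,
    countP_cells, countP_cells, card_cells]
  push_cast
  rw [← Finset.sum_add_distrib, ← Finset.sum_add_distrib, ← Finset.sum_sub_distrib,
    ← Finset.sum_sub_distrib]
  refine Finset.sum_congr rfl fun i _ => ?_
  have hlen := length_eq_count_zero_add (markedRun z i)
  have hfol : ∀ c : ℕ, ¬ Follows startCell ((i : ℤ) - s, c, true) ↔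
      s ≤ i ∨ (i + 1 = s ∧ c = 0) := by
    intro c
    rw [follows_of_marked rfl]
    simp only [startCell]
    omega
  simp only [hfol, markedMult]
  rcases Nat.lt_or_ge i s with h | h
  · have h1 : ∀ l : List ℕ, l.countP (fun c => decide ((i : ℤ) - s < 0 ∧ 0 < c)) =
        l.countP (fun c => 0 < c) := by
      intro l
      refine List.countP_congr fun c _ => ?_
      simp only [decide_eq_true_eq]
      omega
    rw [h1, h1, if_pos h]
    by_cases h' : i + 1 < s
    · rw [if_pos h', List.countP_eq_zero.2]
      · push_cast
        omega
      · intro c _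
        simp only [decide_eq_true_eq]
        omega
    · rw [if_neg h', List.countP_congr (q := fun c => c == 0)]
      · rw [← List.count]
        omega
      · intro c _
        simp only [decide_eq_true_eq, beq_iff_eq]
        omega
  · have h1 : ∀ l : List ℕ, l.countP (fun c => decide ((i : ℤ) - s < 0 ∧ 0 < c)) = 0 := by
      intro l
      rw [List.countP_eq_zero]
      intro c _
      simp only [decide_eq_true_eq]
      omega
    rw [h1, h1, if_neg (by omega), if_neg (by omega), List.countP_eq_length.2]
    · omega
    · intro c _
      simp only [decide_eq_true_eq]
      omega

end Bonus

/-! ### Paths as words of cells -/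

/-- At a height `y < n` the rightmost point of the path is the start of the vertical step in row
`y`, so the extreme line is met at a minimal area letter. At height `n` only shift `0` is possible.
-/
theorem SquarePath.shift_eq {n : ℕ} (π : SquarePath n) (s : ℕ)
    (hle : ∀ i, -(s : ℤ) ≤ π.areaWord i) (hex : ∃ i, π.areaWord i = -(s : ℤ)) : π.shift = s := by
  refine IsGreatest.csSup_eq ⟨?_, ?_⟩
  · obtain ⟨i, hi⟩ := hex
    have hc : π.col i = i + s := by
      simp only [SquarePath.areaWord] at hi
      omega
    refine ⟨i, ?_, i.2.le, ?_, ?_⟩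
    · rw [← hc]; exact (π.col_lt i).le
    · intro j hj; rw [← hc]; exact π.col_mono (by rw [Fin.le_def]; omega)
    · intro j hj; rw [← hc]; exact π.col_mono (by rw [Fin.le_def]; omega)
  · rintro t ⟨y, hx, hy, -, h2⟩
    rcases Nat.lt_or_ge y n with h | h
    · have h3 := h2 ⟨y, h⟩ le_rfl
      have h4 := hle ⟨y, h⟩
      simp only [SquarePath.areaWord] at h4
      omega
    · omega

theorem SquarePath.neg_shift_le {n : ℕ} (π : SquarePath n) (i : Fin n) :
    -(π.shift : ℤ) ≤ π.areaWord i := by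
  have : Nonempty (Fin n) := ⟨i⟩
  obtain ⟨j, hj⟩ := Finite.exists_min π.areaWord
  have h0 : π.areaWord j ≤ 0 := by
    refine (hj ⟨0, i.pos⟩).trans ?_
    simp [SquarePath.areaWord]
  have := π.shift_eq (-π.areaWord j).toNat (fun i => by have := hj i; omega) ⟨j, by omega⟩
  have := hj i
  omega

theorem le_add_of_step {n : ℕ} {a : Fin n → ℤ} (h : ∀ i j : Fin n, (i : ℕ) + 1 = j → a j ≤ a i + 1)
    {i j : Fin n} (hij : i ≤ j) : a j ≤ a i + ((j : ℤ) - i) := by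
  obtain ⟨k, hk⟩ : ∃ k, (j : ℕ) = i + k := ⟨j - i, by rw [Fin.le_def] at hij; omega⟩
  clear hij
  induction k generalizing j with
  | zero =>
    obtain rfl : j = i := Fin.ext (by omega)
    simp
  | succ k ih =>
    have h1 := ih (j := ⟨i + k, by omega⟩) rfl
    have h2 := h ⟨i + k, by omega⟩ j (by simp only; omega)
    simp only at h1
    push_cast at h1
    omega

/-- A discrete intermediate value theorem: going back from `j`, the first value that is at most `d`
must equal `d`, as rises are at most `1`. -/
theorem exists_step {n : ℕ} {a : Fin n → ℤ} (h : ∀ i j : Fin n, (i : ℕ) + 1 = j → a j ≤ a i + 1)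
    {i j : Fin n} (hij : i ≤ j) {d : ℤ} (hi : a i ≤ d) (hj : d < a j) :
    ∃ k k' : Fin n, (k : ℕ) + 1 = k' ∧ a k = d ∧ a k' = d + 1 := by
  obtain ⟨m, hm⟩ : ∃ m, (j : ℕ) = i + m := ⟨j - i, by rw [Fin.le_def] at hij; omega⟩
  clear hij
  induction m generalizing j with
  | zero =>
    obtain rfl : j = i := Fin.ext (by omega)
    omega
  | succ m ih =>
    have h2 := h ⟨i + m, by omega⟩ j (by simp only; omega)
    by_cases hd : d < a ⟨i + m, by omega⟩
    · exact ih hd rfl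
    · exact ⟨⟨i + m, by omega⟩, j, by simp only; omega, by omega, by omega⟩

theorem isChain_cons_ofFn_append {α : Type*} {R : α → α → Prop} {n : ℕ} (hn : 0 < n)
    (g : Fin n → α) (p e : α) :
    List.IsChain R (p :: (List.ofFn g ++ [e])) ↔
      R p (g ⟨0, hn⟩) ∧ (∀ i j : Fin n, (i : ℕ) + 1 = j → R (g i) (g j)) ∧
        R (g ⟨n - 1, by omega⟩) e := by
  have hne : List.ofFn g ≠ [] := by rw [ne_eq, List.ofFn_eq_nil_iff]; omega
  have h1 : (List.ofFn g ++ [e]).head? = some (g ⟨0, hn⟩) := by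
    rw [List.head?_append_of_ne_nil _ hne, List.head?_eq_some_head hne, List.head_ofFn]
  have h2 : (List.ofFn g).getLast? = some (g ⟨n - 1, by omega⟩) := by
    rw [List.getLast?_eq_some_getLast hne, List.getLast_ofFn]
  rw [List.isChain_cons, h1, List.isChain_append, h2, List.isChain_ofFn]
  simp only [Option.mem_some_iff, forall_eq', List.IsChain.singleton, List.head?_cons, true_and]
  refine and_congr_right fun _ => and_congr_left fun _ => ⟨fun h i j hij => ?_, fun h i hi => ?_⟩
  · have := h i (by omega)
    convert this
    exact hij.symm
  · exact h _ _ rfl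

namespace DecoratedSquarePath

variable {n : ℕ} (P : DecoratedSquarePath n)

/-- The datum of the `i`-th vertical step. -/
def cell (i : Fin n) : Cell := (P.areaWord i, P.label i, decide (i ∈ P.dv))

/-- The word of cells that describes a path. -/
def toCells : List Cell := List.ofFn P.cell

theorem areaWord_step (i j : Fin n) (hij : (i : ℕ) + 1 = j) :
    P.areaWord j ≤ P.areaWord i + 1 := by
  have := P.col_mono (show i ≤ j by rw [Fin.le_def]; omega)
  simp only [SquarePath.areaWord]
  omega

theorem areaWord_zero_nonpos (i : Fin n) (hi : (i : ℕ) = 0) : P.areaWord i ≤ 0 := by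
  simp [SquarePath.areaWord, hi]

theorem areaWord_last_nonneg (i : Fin n) (hi : (i : ℕ) + 1 = n) : 0 ≤ P.areaWord i := by
  have := P.col_lt i
  simp only [SquarePath.areaWord]
  omega

/-- The conditions on the first step are those for coming after an undecorated label `0` on the line
`y = x - 1`. The final east step means that the last area letter is nonnegative, which is what
`stopCell` tests. -/
theorem isChain_toCells (hn : 0 < n) {N : ℕ} (hN : ∀ i, P.label i < N) :
    List.IsChain Follows (startCell :: (P.toCells ++ [stopCell N])) := by
  rw [toCells, isChain_cons_ofFn_append hn]
  refine ⟨?_, ?_, ?_⟩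
  · have h0 := P.areaWord_zero_nonpos ⟨0, hn⟩ rfl
    by_cases hd : (⟨0, hn⟩ : Fin n) ∈ P.dv
    · rw [follows_of_marked (by simpa [cell] using hd)]
      rcases P.dv_valley _ hd with ⟨-, h⟩ | ⟨i, hi, -⟩
      · simpa [cell, startCell] using h
      · simp at hi
    · rw [follows_of_unmarked (by simpa [cell] using hd)]
      have := P.first_pos ⟨0, hn⟩ rfl
      simp only [cell, startCell]
      omega
  · intro i j hij
    by_cases hd : j ∈ P.dv
    · rw [follows_of_marked (by simpa [cell] using hd)]
      rcases P.dv_valley _ hd with ⟨h, -⟩ | ⟨i', hi', h⟩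
      · omega
      · obtain rfl : i' = i := Fin.ext (by omega)
        exact h
    · rw [follows_of_unmarked (by simpa [cell] using hd)]
      have h1 := P.areaWord_step i j hij
      have h2 := P.label_lt i j hij
      simp only [cell]
      omega
  · rw [follows_of_unmarked rfl]
    have h1 := P.areaWord_last_nonneg ⟨n - 1, by omega⟩ (by simp only; omega)
    have h2 := hN ⟨n - 1, by omega⟩
    simp only [cell, stopCell]
    omega

theorem diagonal_cast (i : Fin n) : (P.diagonal i : ℤ) = P.areaWord i + P.shift := by
  have := P.neg_shift_le i
  rw [diagonal]
  omega

end DecoratedSquarePath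

theorem toCells_injective :
    Function.Injective (fun P : Σ n, DecoratedSquarePath n => P.2.toCells) := by
  rintro ⟨n, P⟩ ⟨m, Q⟩ h
  simp only [DecoratedSquarePath.toCells] at h
  obtain rfl : n = m := by simpa using congrArg List.length h
  have h := List.ofFn_injective h
  have h' : ∀ i, P.areaWord i = Q.areaWord i ∧ P.label i = Q.label i ∧ (i ∈ P.dv ↔ i ∈ Q.dv) := by
    intro i
    simpa [DecoratedSquarePath.cell] using congrFun h i
  obtain ⟨⟨⟨c, c1, c2⟩, w, w1, w2, w3⟩, D, D1⟩ := P
  obtain ⟨⟨⟨c', c1', c2'⟩, w', w1', w2', w3'⟩, D', D1'⟩ := Q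
  obtain rfl : c = c' := by
    funext i
    have := (h' i).1
    simpa [SquarePath.areaWord] using this
  obtain rfl : w = w' := funext fun i => (h' i).2.1
  obtain rfl : D = D' := Finset.ext fun i => (h' i).2.2
  rfl

/-- The columns must be `i - a_i`. Area letters rise by at most `1`, so the columns increase weakly;
they are nonnegative because the first letter is at most `0`, and smaller than `n` because
`stopCell` forces the last letter to be at least `0`. -/
theorem exists_path {n : ℕ} (hn : 0 < n) (g : Fin n → Cell) (s N : ℕ)
    (hchain : List.IsChain Follows (startCell :: (List.ofFn g ++ [stopCell N])))
    (hle : ∀ i, -(s : ℤ) ≤ (g i).1) (hex : ∃ i, (g i).1 = -(s : ℤ) ∧ 0 < (g i).2.1) :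
    ∃ P : DecoratedSquarePath n, P.shift = s ∧ P.cell = g := by
  rw [isChain_cons_ofFn_append hn] at hchain
  obtain ⟨hstart, hstep, hlast⟩ := hchain
  rw [follows_of_unmarked rfl] at hlast
  simp only [stopCell] at hlast
  have hs : ∀ i j : Fin n, (i : ℕ) + 1 = j → (g j).1 ≤ (g i).1 + 1 := by
    intro i j hij
    have := hstep i j hij
    unfold Follows at this
    omega
  have h0 : (g ⟨0, hn⟩).1 ≤ 0 := by
    unfold Follows at hstart
    simp only [startCell] at hstart
    omega
  have hle' : ∀ i j : Fin n, i ≤ j → (g j).1 ≤ (g i).1 + ((j : ℤ) - i) :=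
    fun i j hij => le_add_of_step (a := fun i => (g i).1) hs hij
  have hi : ∀ i : Fin n, (g i).1 ≤ i := by
    intro i
    have := hle' ⟨0, hn⟩ i (by simp [Fin.le_def])
    simp only [Nat.cast_zero] at this
    omega
  let π : SquarePath n :=
    { col := fun i => ((i : ℤ) - (g i).1).toNat
      col_mono := by
        intro i j hij
        have := hle' i j hij
        simp only
        omega
      col_lt := by
        intro i
        have := hle' i ⟨n - 1, by omega⟩ (by rw [Fin.le_def]; simp only; omega)
        simp only at this ⊢
        omega }
  have harea : ∀ i, π.areaWord i = (g i).1 := by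
    intro i
    have := hi i
    simp only [SquarePath.areaWord, π]
    omega
  have hshift : π.shift = s := by
    refine π.shift_eq s (fun i => by rw [harea]; exact hle i) ?_
    obtain ⟨i, h, _⟩ := hex
    exact ⟨i, (harea i).trans h⟩
  let Q : LabelledSquarePath n :=
    { π with
      label := fun i => (g i).2.1
      label_lt := by
        intro i j hij h
        change π.areaWord i < π.areaWord j at h
        rw [harea, harea] at h
        have := hstep i j hij
        unfold Follows at this
        omega
      first_pos := by
        intro i hi h
        change π.areaWord i = 0 at h
        rw [harea] at h
        obtain rfl : i = ⟨0, hn⟩ := Fin.ext hi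
        unfold Follows at hstart
        simp only [startCell] at hstart
        omega
      base_pos := by
        intro _
        obtain ⟨i, h, h'⟩ := hex
        refine ⟨i, ?_, h'⟩
        rw [harea, h, hshift] }
  refine ⟨{ Q with dv := Finset.univ.filter fun i => (g i).2.2 = true, dv_valley := ?_ },
    hshift, ?_⟩
  · intro j hj
    have hj : (g j).2.2 = true := by simpa using hj
    rcases Nat.eq_zero_or_pos j with h | h
    · left
      obtain rfl : j = ⟨0, hn⟩ := Fin.ext h
      refine ⟨rfl, ?_⟩
      rw [follows_of_marked hj] at hstart
      change π.areaWord _ < -1 ∨ (π.areaWord _ = -1 ∧ 0 < (g _).2.1)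
      rw [harea]
      exact hstart
    · right
      refine ⟨⟨j - 1, by omega⟩, by simp only; omega, ?_⟩
      have := hstep ⟨j - 1, by omega⟩ j (by simp only; omega)
      rw [follows_of_marked hj] at this
      change π.areaWord _ < π.areaWord _ ∨ (π.areaWord _ = π.areaWord _ ∧ (g _).2.1 < (g _).2.1)
      rw [harea, harea]
      exact this
  · funext i
    rw [Cell.ext_iff']
    refine ⟨harea i, rfl, ?_⟩
    simp [DecoratedSquarePath.cell]

/-! ### Statistics -/

section Statistics

theorem countP_ofFn {α : Type*} {n : ℕ} (g : Fin n → α) (P : α → Prop) [DecidablePred P] :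
    (List.ofFn g).countP (fun u => P u) = (Finset.univ.filter fun i => P (g i)).card := by
  rw [← Multiset.coe_countP, ← Fin.univ_val_map, Multiset.countP_map]
  rfl

theorem invCount_ofFn {α : Type*} {n : ℕ} (g : Fin n → α) (att : α → α → Prop)
    [DecidableRel att] :
    invCount att (List.ofFn g) =
      (Finset.univ.filter fun p : Fin n × Fin n => p.1 < p.2 ∧ att (g p.1) (g p.2)).card := by
  simp only [Finset.card_filter, Fintype.sum_prod_type]
  induction n with
  | zero => simp [invCount]
  | succ n ih =>
    rw [List.ofFn_succ, invCount, ih, Fin.sum_univ_succ]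
    congr 1
    · rw [countP_ofFn, Finset.card_filter, Fin.sum_univ_succ]
      simp
    · refine Finset.sum_congr rfl fun i _ => ?_
      rw [Fin.sum_univ_succ]
      simp

variable {n : ℕ} (P : DecoratedSquarePath n)

theorem dinv_eq : P.dinv = (invCount Attacks P.toCells : ℤ) +
    (P.toCells.countP (fun u => u.1 < 0 ∧ 0 < u.2.1) : ℤ) -
    (P.toCells.countP (fun u => u.2.2 = true) : ℤ) := by
  rw [DecoratedSquarePath.dinv, DecoratedSquarePath.toCells, invCount_ofFn, countP_ofFn,
    countP_ofFn]
  congr 2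
  · congr 1
    classical
    refine congrArg Finset.card (Finset.ext fun p => ?_)
    rw [Finset.mem_filter, Finset.mem_filter]
    simp only [Finset.mem_univ, true_and, DecoratedSquarePath.IsInversion, Attacks,
      DecoratedSquarePath.cell, decide_eq_false_iff_not]
    tauto
  · congr 1
    ext i
    simp [DecoratedSquarePath.cell]

end Statistics

/-! ### The major index -/

section MajorIndex

/-- The only new descent is at the junction, in position `p.length`; for empty `p` there is none and
the summand is `0`. -/
theorem majorIndex_append {p w : List ℕ} (hw : w ≠ []) (hsort : w.IsChain (· ≤ ·))
    (hdesc : ∀ hp : p ≠ [], w.head hw < p.getLast hp) :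
    majorIndex (p ++ w) = majorIndex p + p.length := by
  have hwl : 0 < w.length := List.length_pos_iff.2 hw
  rw [List.isChain_iff_getElem] at hsort
  have hasc : ∀ i, i < w.length - 1 → ¬ w.getD (i + 1) 0 < w.getD i 0 := by
    intro i hi
    rw [List.getD_eq_getElem _ _ (by omega), List.getD_eq_getElem _ _ (by omega), not_lt]
    exact hsort i (by omega)
  by_cases hp : p = []
  · subst hp
    simp only [majorIndex, List.nil_append, List.length_nil, add_zero, zero_tsub,
      Finset.range_zero, Finset.sum_empty]
    exact Finset.sum_eq_zero fun i hi => if_neg (hasc i (by simpa using hi))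
  · have hpl : 0 < p.length := List.length_pos_iff.2 hp
    have hd := hdesc hp
    rw [List.head_eq_getElem, List.getLast_eq_getElem] at hd
    rw [majorIndex, List.length_append, show p.length + w.length - 1 =
      (p.length - 1 + 1) + (w.length - 1) by omega, Finset.sum_range_add, Finset.sum_range_succ,
      majorIndex]
    rw [Finset.sum_eq_zero (s := Finset.range (w.length - 1)), add_zero]
    · congr 1
      · refine Finset.sum_congr rfl fun i hi => ?_
        rw [Finset.mem_range] at hi
        rw [List.getD_append _ _ _ _ (by omega), List.getD_append _ _ _ _ (by omega)]
      · rw [List.getD_append_right _ _ _ _ (by omega), List.getD_append _ _ _ _ (by omega),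
          show p.length - 1 + 1 - p.length = 0 by omega, List.getD_eq_getElem _ _ hwl,
          List.getD_eq_getElem _ _ (by omega), if_pos hd]
        omega
    · intro i hi
      rw [Finset.mem_range] at hi
      rw [List.getD_append_right _ _ _ _ (by omega), List.getD_append_right _ _ _ _ (by omega),
        show p.length - 1 + 1 + i + 1 - p.length = i + 1 by omega,
        show p.length - 1 + 1 + i - p.length = i by omega, if_neg (hasc i hi)]

theorem sum_length_getD (L : List (List ℕ)) :
    ∑ i ∈ Finset.range L.length, (L.getD i []).length = L.flatten.length := by
  induction L with
  | nil => simp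
  | cons a L ih =>
    rw [List.length_cons, Finset.sum_range_succ']
    simp only [List.getD_cons_succ, List.getD_cons_zero, ih, List.flatten_cons, List.length_append]
    omega

/-- The position of a descent counts the letters weakly to its left, and a letter of the `i`-th
factor from the right (starting with `0`) is counted by the `i` junctions to its right. -/
theorem majorIndex_flatten (L : List (List ℕ)) (hne : [] ∉ L)
    (hsort : ∀ w ∈ L, w.IsChain (· ≤ ·))
    (hdesc : L.IsChain fun a b => ∃ ha hb, b.head hb < a.getLast ha) :
    majorIndex L.flatten = ∑ i ∈ Finset.range L.length, i * (L.reverse.getD i []).length := by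
  induction L using List.reverseRecOn with
  | nil => simp [majorIndex]
  | append_singleton L w ih =>
    have hw : w ≠ [] := by rintro rfl; simp at hne
    rw [List.isChain_append] at hdesc
    rw [List.flatten_append, List.flatten_singleton, majorIndex_append hw (hsort w (by simp)),
      ih (by simp_all) (fun u hu => hsort u (by simp [hu])) hdesc.1]
    · rw [List.reverse_append, List.reverse_singleton, List.singleton_append, List.length_append,
        List.length_singleton, Finset.sum_range_succ']
      simp only [List.getD_cons_succ, add_mul, one_mul, zero_mul, add_zero]
      rw [Finset.sum_add_distrib]
      congr 1
      have := sum_length_getD L.reverse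
      rw [List.length_reverse] at this
      rw [this, List.length_flatten, List.length_flatten, List.map_reverse, List.sum_reverse]
    · intro hp
      have hL : L ≠ [] := by rintro rfl; simp at hp
      obtain ⟨ha, hb, h⟩ := hdesc.2.2 (L.getLast hL) (List.getLast?_eq_some_getLast hL) w (by simp)
      have : L.flatten.getLast hp = (L.getLast hL).getLast ha := by
        have e : L.flatten = L.dropLast.flatten ++ L.getLast hL := by
          conv_lhs => rw [← List.dropLast_append_getLast hL]
          simp
        simp only [e, List.getLast_append_of_ne_nil _ ha]
      rw [this]
      exact h

theorem maj_eq (z : MarkedWord) :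
    maj z = ∑ i ∈ Finset.range (runs z).length, i * (run z i).length := by
  have hz : z.map MarkedLetter.val = ((runs z).map (List.map MarkedLetter.val)).flatten := by
    rw [← List.map_flatten, runs, List.flatten_splitBy]
  rw [maj, hz, majorIndex_flatten]
  · rw [List.length_map]
    refine Finset.sum_congr rfl fun i _ => ?_
    rw [← List.map_reverse, run]
    congr 1
    rw [show ([] : List ℕ) = List.map MarkedLetter.val [] from rfl, List.getD_map, List.length_map]
  · intro h
    obtain ⟨w, hw, h⟩ := List.mem_map.1 h
    exact List.ne_nil_of_mem_splitBy hw (List.map_eq_nil_iff.1 h)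
  · intro w hw
    obtain ⟨u, hu, rfl⟩ := List.mem_map.1 hw
    rw [List.isChain_map]
    simpa using List.isChain_of_mem_splitBy hu
  · rw [List.isChain_map]
    refine (List.isChain_getLast_head_splitBy _ z).imp ?_
    rintro a b ⟨ha, hb, h⟩
    refine ⟨by simpa using ha, by simpa using hb, ?_⟩
    simpa [List.getLast_map, List.head_map] using h

end MajorIndex

/-! ### Runs of diagonal words -/

section DiagonalWord

theorem le_getLast_of_pairwise {α : Type*} [Preorder α] {l : List α} (h : l.Pairwise (· ≤ ·))
    {a : α} (ha : a ∈ l) : a ≤ l.getLast (List.ne_nil_of_mem ha) := by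
  have hl := List.ne_nil_of_mem ha
  rw [← List.dropLast_append_getLast hl, List.pairwise_append] at h
  rw [← List.dropLast_append_getLast hl, List.mem_append] at ha
  rcases ha with ha | ha
  · exact h.2.2 a ha _ (by simp)
  · exact (List.mem_singleton.1 ha).le

theorem head_le_of_pairwise {α : Type*} [Preorder α] {l : List α} (h : l.Pairwise (· ≤ ·))
    {a : α} (ha : a ∈ l) : l.head (List.ne_nil_of_mem ha) ≤ a := by
  cases l with
  | nil => simp at ha
  | cons b l =>
    rcases List.mem_cons.1 ha with rfl | ha
    · exact le_rfl
    · exact (List.pairwise_cons.1 h).1 a ha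

theorem MarkedLetter.val_le_val {a b : MarkedLetter} (h : a ≤ b) : a.val ≤ b.val :=
  Prod.Lex.monotone_fst_ofLex h

variable {n : ℕ} (P : DecoratedSquarePath n)

theorem coe_diagonalRun (d : ℕ) : (P.diagonalRun d : Multiset MarkedLetter) =
    (Finset.univ.filter fun i => P.diagonal i = d).val.map P.markedLabel :=
  Multiset.sort_eq _ _

theorem mem_diagonalRun {d : ℕ} {a : MarkedLetter} :
    a ∈ P.diagonalRun d ↔ ∃ i, P.diagonal i = d ∧ P.markedLabel i = a := by
  rw [← Multiset.mem_coe, coe_diagonalRun]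
  simp

theorem pairwise_diagonalRun (d : ℕ) : (P.diagonalRun d).Pairwise (· ≤ ·) :=
  Multiset.pairwise_sort _ _

/-- Some vertical step leads from the diagonal `d` to the diagonal `d + 1`. -/
theorem exists_diagonal_step (hn : 0 < n) {d : ℕ} (hd : d < Finset.univ.sup P.diagonal) :
    ∃ i j, P.diagonal i = d ∧ P.diagonal j = d + 1 ∧ P.label i < P.label j := by
  have key : ∃ k k' : Fin n, (k : ℕ) + 1 = k' ∧ P.areaWord k = (d : ℤ) - P.shift ∧
      P.areaWord k' = (d : ℤ) - P.shift + 1 := by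
    -- Below the main diagonal the path climbs from its base to the last vertical step; from the
    -- main diagonal on it climbs from the first vertical step to a highest one.
    by_cases hds : d < P.shift
    · obtain ⟨i, hi, -⟩ := P.base_pos hn
      have hl := P.areaWord_last_nonneg ⟨n - 1, by omega⟩ (by simp only; omega)
      refine exists_step P.areaWord_step (i := i) (j := ⟨n - 1, by omega⟩)
        (by rw [Fin.le_def]; simp only; omega) ?_ ?_
      · omega
      · omega
    · obtain ⟨j, -, hj⟩ := Finset.exists_mem_eq_sup Finset.univ ⟨⟨0, hn⟩, Finset.mem_univ _⟩
        P.diagonal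
      have hf := P.areaWord_zero_nonpos ⟨0, hn⟩ rfl
      have hdj := P.diagonal_cast j
      refine exists_step P.areaWord_step (i := ⟨0, hn⟩) (j := j)
        (by simp [Fin.le_def]) ?_ ?_
      · omega
      · omega
  obtain ⟨k, k', hkk, h1, h2⟩ := key
  have e1 := P.diagonal_cast k
  have e2 := P.diagonal_cast k'
  exact ⟨k, k', by omega, by omega, P.label_lt k k' hkk (by omega)⟩

theorem exists_diagonal_eq (hn : 0 < n) {d : ℕ} (hd : d ≤ Finset.univ.sup P.diagonal) :
    ∃ i, P.diagonal i = d := by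
  rcases hd.lt_or_eq with hd | rfl
  · obtain ⟨i, -, h, -⟩ := exists_diagonal_step P hn hd
    exact ⟨i, h⟩
  · obtain ⟨j, -, hj⟩ := Finset.exists_mem_eq_sup Finset.univ ⟨⟨0, hn⟩, Finset.mem_univ _⟩
      P.diagonal
    exact ⟨j, hj.symm⟩

/-- Some vertical step from diagonal `d` leads to diagonal `d + 1`, and labels increase in columns.
So the largest label on diagonal `d + 1` exceeds the smallest on diagonal `d`, which gives a descent
between the two factors. -/
theorem runs_diagonalWord (hn : 0 < n) : runs P.diagonalWord =
    (List.range (Finset.univ.sup P.diagonal + 1)).reverse.map P.diagonalRun := by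
  refine List.splitBy_flatten ?_ ?_ ?_
  · intro h
    obtain ⟨d, hd, h⟩ := List.mem_map.1 h
    rw [List.mem_reverse, List.mem_range] at hd
    obtain ⟨i, hi⟩ := exists_diagonal_eq P hn (d := d) (by omega)
    have : P.markedLabel i ∈ P.diagonalRun d := (mem_diagonalRun P).2 ⟨i, hi, rfl⟩
    simp [h] at this
  · intro m hm
    obtain ⟨d, -, rfl⟩ := List.mem_map.1 hm
    refine ((pairwise_diagonalRun P d).imp fun h => ?_).isChain
    simpa using MarkedLetter.val_le_val h
  · rw [List.isChain_map, List.isChain_reverse]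
    refine (List.isChain_range_succ _ _).2 fun m hm => ?_
    obtain ⟨i, j, hi, hj, hij⟩ := exists_diagonal_step P hn hm
    have hi : P.markedLabel i ∈ P.diagonalRun m := (mem_diagonalRun P).2 ⟨i, hi, rfl⟩
    have hj : P.markedLabel j ∈ P.diagonalRun (m + 1) := (mem_diagonalRun P).2 ⟨j, hj, rfl⟩
    refine ⟨List.ne_nil_of_mem hj, List.ne_nil_of_mem hi, ?_⟩
    have h1 := MarkedLetter.val_le_val (head_le_of_pairwise (pairwise_diagonalRun P m) hi)
    have h2 := MarkedLetter.val_le_val (le_getLast_of_pairwise (pairwise_diagonalRun P (m + 1)) hj)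
    have h3 : (P.markedLabel i).val < (P.markedLabel j).val := hij
    simp only [Nat.succ_eq_add_one, decide_eq_false_iff_not, not_le]
    omega

theorem length_runs_diagonalWord (hn : 0 < n) :
    (runs P.diagonalWord).length = Finset.univ.sup P.diagonal + 1 := by
  rw [runs_diagonalWord P hn]
  simp

theorem run_diagonalWord (hn : 0 < n) (d : ℕ) : run P.diagonalWord d = P.diagonalRun d := by
  by_cases hd : d < Finset.univ.sup P.diagonal + 1
  · rw [run, runs_diagonalWord P hn, ← List.map_reverse, List.reverse_reverse,
      List.getD_eq_getElem _ _ (by simpa using hd)]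
    simp
  · rw [run_eq_nil _ (by rw [length_runs_diagonalWord P hn]; omega), eq_comm,
      List.eq_nil_iff_forall_not_mem]
    intro a ha
    obtain ⟨i, hi, -⟩ := (mem_diagonalRun P).1 ha
    have := Finset.le_sup (f := P.diagonal) (Finset.mem_univ i)
    omega

theorem area_eq (hn : 0 < n) : P.area = maj P.diagonalWord := by
  rw [maj_eq, length_runs_diagonalWord P hn, DecoratedSquarePath.area,
    ← Finset.sum_fiberwise_of_maps_to (s := Finset.univ)
    (t := Finset.range (Finset.univ.sup P.diagonal + 1)) (g := P.diagonal)]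
  · refine Finset.sum_congr rfl fun d _ => ?_
    rw [Finset.sum_congr rfl (g := fun _ => d) (fun i hi => (Finset.mem_filter.1 hi).2),
      Finset.sum_const, run_diagonalWord P hn, smul_eq_mul, mul_comm]
    congr 1
    have := congrArg Multiset.card (coe_diagonalRun P d)
    rw [Multiset.card_map] at this
    exact this.symm
  · intro i _
    rw [Finset.mem_range]
    have := Finset.le_sup (f := P.diagonal) (Finset.mem_univ i)
    omega

theorem prod_map_reverse_range {A : Type*} [CommMonoid A] (f : ℕ → A) (m : ℕ) :
    ((List.range m).reverse.map f).prod = ∏ i ∈ Finset.range m, f i := by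
  induction m with
  | zero => simp
  | succ m ih =>
    rw [List.range_succ, List.reverse_append, Finset.prod_range_succ, ← ih]
    simp [mul_comm]

theorem monomial_eq {A : Type*} [CommRing A] (x : ℕ → A) :
    P.monomial x = wordMonomial x P.diagonalWord := by
  rw [wordMonomial, DecoratedSquarePath.diagonalWord, List.map_flatten, List.prod_flatten,
    List.map_map, List.map_map, prod_map_reverse_range, DecoratedSquarePath.monomial,
    ← Finset.prod_fiberwise_of_maps_to (s := Finset.univ)
    (t := Finset.range (Finset.univ.sup P.diagonal + 1)) (g := P.diagonal)]
  · refine Finset.prod_congr rfl fun d _ => ?_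
    rw [Function.comp_apply, Function.comp_apply, ← Multiset.prod_coe, ← Multiset.map_coe,
      coe_diagonalRun, Multiset.map_map]
    rfl
  · intro i _
    rw [Finset.mem_range]
    have := Finset.le_sup (f := P.diagonal) (Finset.mem_univ i)
    omega

end DiagonalWord

/-! ### The bijection between paths and chains of cells. -/

section AllCells

variable (z : MarkedWord) (s : ℕ)

/-- The multiset of cells of a path with shift `s` and diagonal word `z`. -/
def allCells : Multiset Cell :=
  ∑ d ∈ Finset.range (runs z).length,
    (run z d : Multiset MarkedLetter).map fun a => ((d : ℤ) - s, ofLex a)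

theorem unmarkedCells_add_markedCells : unmarkedCells z s + markedCells z s = allCells z s := by
  rw [unmarkedCells, markedCells, cells, cells, ← Finset.sum_add_distrib, allCells]
  refine Finset.sum_congr rfl fun d _ => ?_
  rw [unmarkedRun, markedRun, ← Multiset.map_coe, ← Multiset.map_coe, Multiset.map_map,
    Multiset.map_map, ← Multiset.filter_coe, ← Multiset.filter_coe]
  conv_rhs => rw [← Multiset.filter_add_not (fun a : MarkedLetter => a.marked = false)
    (run z d : Multiset MarkedLetter), Multiset.map_add]
  congr 1
  · refine Multiset.map_congr rfl fun a ha => ?_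
    exact Prod.ext rfl (Prod.ext rfl (Multiset.mem_filter.1 ha).2.symm)
  · refine Multiset.map_congr (Multiset.filter_congr fun a _ => by simp) fun a ha => ?_
    have : a.marked = true := by simpa using (Multiset.mem_filter.1 ha).2
    exact Prod.ext rfl (Prod.ext rfl this.symm)

variable {z s}

theorem mem_allCells {v : Cell} :
    v ∈ allCells z s ↔ ∃ d < (runs z).length, ∃ a ∈ run z d, ((d : ℤ) - s, ofLex a) = v := by
  simp [allCells, Multiset.mem_sum]

theorem neg_le_of_mem_allCells {v : Cell} (hv : v ∈ allCells z s) : -(s : ℤ) ≤ v.1 := by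
  obtain ⟨d, -, a, -, rfl⟩ := mem_allCells.1 hv
  simp only
  omega

theorem count_allCells (d : ℕ) (a : MarkedLetter) :
    (allCells z s).count ((d : ℤ) - s, ofLex a) =
      Multiset.count a (run z d : Multiset MarkedLetter) := by
  rw [allCells, Multiset.count_sum']
  have h : ∀ j ∈ Finset.range (runs z).length, Multiset.count ((d : ℤ) - s, ofLex a)
      ((run z j : Multiset MarkedLetter).map fun a => ((j : ℤ) - s, ofLex a)) =
      if j = d then Multiset.count a (run z d : Multiset MarkedLetter) else 0 := by
    intro j _
    split_ifs with h
    · subst h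
      refine Multiset.count_map_eq_count' (fun a : MarkedLetter => (((j : ℤ) - s, ofLex a) : Cell))
        _ ?_ a
      intro b c hbc
      exact ofLex_inj.1 (Prod.ext_iff.1 hbc).2
    · rw [Multiset.count_eq_zero]
      intro hm
      obtain ⟨b, -, hb⟩ := Multiset.mem_map.1 hm
      have := (Prod.ext_iff.1 hb).1
      simp only at this
      omega
  rw [Finset.sum_congr rfl h, Finset.sum_ite_eq']
  split_ifs with h
  · rfl
  · rw [run_eq_nil z (by simpa using h), Multiset.coe_nil, Multiset.count_zero]

theorem count_toCells {n : ℕ} {P : DecoratedSquarePath n} (hP : P.shift = s) (d : ℕ)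
    (a : MarkedLetter) :
    Multiset.count ((d : ℤ) - s, ofLex a) (P.toCells : Multiset Cell) =
      Multiset.count a (P.diagonalRun d : Multiset MarkedLetter) := by
  rw [coe_diagonalRun, DecoratedSquarePath.toCells,
    ← Fin.univ_val_map, Multiset.count_map, Multiset.count_map, Finset.filter_val,
    Multiset.filter_filter]
  congr 1
  refine Multiset.filter_congr fun i _ => ?_
  have h := P.diagonal_cast i
  rw [hP] at h
  rw [Prod.ext_iff]
  have h1 : ofLex a = (P.cell i).2 ↔ a = P.markedLabel i := by
    rw [← ofLex_inj]
    rfl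
  simp only [h1]
  have h2 : (P.cell i).1 = P.areaWord i := rfl
  rw [h2, and_comm]
  refine and_congr_right fun _ => ?_
  omega

theorem coe_toCells_eq {n : ℕ} (hn : 0 < n) {P : DecoratedSquarePath n} (hP : P.shift = s)
    (hz : P.diagonalWord = z) : (P.toCells : Multiset Cell) = allCells z s := by
  ext v
  by_cases hv : -(s : ℤ) ≤ v.1
  · obtain ⟨d, hd⟩ : ∃ d : ℕ, v = ((d : ℤ) - s, ofLex (toLex v.2)) :=
      ⟨(v.1 + s).toNat, Prod.ext (by simp only; omega) rfl⟩
    rw [hd, count_toCells hP, count_allCells, ← hz, run_diagonalWord P hn]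
  · rw [Multiset.count_eq_zero.2 fun h => hv (neg_le_of_mem_allCells h), Multiset.count_eq_zero]
    intro h
    obtain ⟨i, rfl⟩ := List.mem_ofFn.1 (Multiset.mem_coe.1 h)
    have := P.neg_shift_le i
    rw [hP] at this
    exact hv this

theorem runs_eq_map_run : runs z = (List.range (runs z).length).reverse.map (run z) := by
  rw [List.map_reverse, ← List.reverse_eq_iff]
  refine List.ext_getElem (by simp) fun i h1 h2 => ?_
  rw [List.getElem_map, List.getElem_range, run, List.getD_eq_getElem _ _ h1]

theorem run_mem_runs {d : ℕ} (hd : d < (runs z).length) : run z d ∈ runs z := by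
  rw [run, List.getD_eq_getElem _ _ (by simpa using hd), ← List.mem_reverse]
  exact List.getElem_mem _

theorem run_ne_nil {d : ℕ} (hd : d < (runs z).length) : run z d ≠ [] :=
  List.ne_nil_of_mem_splitBy (run_mem_runs hd)

/-- Equal cells and equal shift give the same multiset of marked letters on each diagonal. Sorted
lists with the same multiset coincide; this is where the order `c < c• < c + 1` in the runs of `z`
matters. -/
theorem diagonalWord_eq {n : ℕ} (hn : 0 < n) {P : DecoratedSquarePath n} (hz : z ≠ [])
    (hsorted : ∀ ρ ∈ runs z, ρ.Pairwise (fun a b => a ≤ b)) (hP : P.shift = s)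
    (hcells : (P.toCells : Multiset Cell) = allCells z s) : P.diagonalWord = z := by
  have hrun : ∀ d, P.diagonalRun d = run z d := by
    intro d
    refine List.Perm.eq_of_pairwise (le := (· ≤ ·)) (fun a b _ _ h1 h2 => le_antisymm h1 h2)
      (pairwise_diagonalRun P d) ?_ ?_
    · rcases Nat.lt_or_ge d (runs z).length with h | h
      · exact hsorted _ (run_mem_runs h)
      · rw [run_eq_nil z h]
        exact List.Pairwise.nil
    · rw [← Multiset.coe_eq_coe]
      ext a
      rw [← count_toCells hP, ← count_allCells (s := s), hcells]
  have hlen : Finset.univ.sup P.diagonal + 1 = (runs z).length := by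
    have hpos : 0 < (runs z).length := List.length_pos_iff.2 (List.splitBy_ne_nil.2 hz)
    refine le_antisymm ?_ ?_
    · obtain ⟨i, hi⟩ := exists_diagonal_eq P hn (d := Finset.univ.sup P.diagonal) le_rfl
      by_contra h
      have := (mem_diagonalRun P).2 ⟨i, hi, rfl⟩
      rw [hrun, run_eq_nil z (by omega)] at this
      simp at this
    · obtain ⟨a, ha⟩ := List.exists_mem_of_ne_nil _
        (run_ne_nil (z := z) (d := (runs z).length - 1) (by omega))
      rw [← hrun] at ha
      obtain ⟨i, hi, -⟩ := (mem_diagonalRun P).1 ha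
      have := Finset.le_sup (f := P.diagonal) (Finset.mem_univ i)
      omega
  rw [DecoratedSquarePath.diagonalWord, hlen, List.map_congr_left (fun d _ => hrun d),
    ← runs_eq_map_run, runs, List.flatten_splitBy]

theorem diagonalWord_of_size_zero (P : DecoratedSquarePath 0) : P.diagonalWord = [] := by
  rw [List.eq_nil_iff_forall_not_mem]
  intro a ha
  rw [DecoratedSquarePath.diagonalWord, List.mem_flatten] at ha
  obtain ⟨ρ, hρ, ha⟩ := ha
  obtain ⟨d, -, rfl⟩ := List.mem_map.1 hρ
  obtain ⟨i, -⟩ := (mem_diagonalRun P).1 ha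
  exact i.elim0

theorem bijOn_toCells (hz : z ≠ []) (hsorted : ∀ ρ ∈ runs z, ρ.Pairwise (fun a b => a ≤ b))
    (hbase : ∃ a ∈ run z 0, 0 < a.val) {N : ℕ} (hN : ∀ v ∈ allCells z s, v.2.1 < N) :
    Set.BijOn (fun P : Σ n, DecoratedSquarePath n => P.2.toCells) (pathsWith s z)
      ((arrangements (allCells z s)).filter
        fun l => List.IsChain Follows (startCell :: (l ++ [stopCell N])) : Finset (List Cell)) := by
  have hlen : 0 < (runs z).length := List.length_pos_iff.2 (List.splitBy_ne_nil.2 hz)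
  refine ⟨?_, toCells_injective.injOn, ?_⟩
  · rintro ⟨n, P⟩ ⟨hP, hw⟩
    simp only at hP hw
    have hn : 0 < n := by
      by_contra h
      obtain rfl : n = 0 := by omega
      apply hz
      rw [← hw, diagonalWord_of_size_zero]
    have hc := coe_toCells_eq hn hP hw
    rw [Finset.mem_coe, Finset.mem_filter, mem_arrangements]
    refine ⟨hc, P.isChain_toCells hn fun i => hN (P.cell i) ?_⟩
    rw [← hc, Multiset.mem_coe]
    exact List.mem_ofFn.2 ⟨i, rfl⟩
  · intro l hl
    rw [Finset.mem_coe, Finset.mem_filter, mem_arrangements] at hl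
    obtain ⟨hl, hchain⟩ := hl
    have hmem : ∀ v, v ∈ l ↔ v ∈ allCells z s := fun v => by rw [← hl, Multiset.mem_coe]
    obtain ⟨a, ha, hpos⟩ := hbase
    -- A positive letter of the last run puts a cell on diagonal `0`: it makes the shift exactly `s`
    -- and provides the positive label on the base diagonal.
    have hcell : ((((0 : ℕ) : ℤ) - s, ofLex a) : Cell) ∈ l :=
      (hmem _).2 (mem_allCells.2 ⟨0, hlen, a, ha, rfl⟩)
    have hn : 0 < l.length := List.length_pos_of_mem hcell
    rw [← List.ofFn_get l] at hchain
    obtain ⟨P, hP, hg⟩ := exists_path hn l.get s N hchain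
      (fun i => neg_le_of_mem_allCells ((hmem _).1 (List.get_mem _ _))) (by
        obtain ⟨i, hi⟩ := List.get_of_mem hcell
        refine ⟨i, ?_, ?_⟩
        · rw [hi]; simp
        · rw [hi]; exact hpos)
    have hto : P.toCells = l := by rw [DecoratedSquarePath.toCells, hg, List.ofFn_get]
    exact ⟨⟨l.length, P⟩, ⟨hP, diagonalWord_eq hn hz hsorted hP (by rw [hto, hl])⟩, hto⟩

end AllCells

/-! ### The empty word. -/

section EmptyWord

/-- The empty path. -/
def emptyPath : DecoratedSquarePath 0 where
  col i := i.elim0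
  col_mono i := i.elim0
  col_lt i := i.elim0
  label i := i.elim0
  label_lt i := i.elim0
  first_pos i := i.elim0
  base_pos h := absurd h (lt_irrefl 0)
  dv := ∅
  dv_valley i := i.elim0

theorem pathsWith_nil : pathsWith 0 [] = {⟨0, emptyPath⟩} := by
  ext ⟨n, P⟩
  rw [Set.mem_singleton_iff]
  constructor
  · rintro ⟨-, hw⟩
    simp only at hw
    rcases Nat.eq_zero_or_pos n with rfl | hn
    · refine toCells_injective ?_
      simp [DecoratedSquarePath.toCells]
    · have := length_runs_diagonalWord P hn
      rw [hw] at this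
      simp [runs] at this
  · intro h
    rw [h]
    refine ⟨?_, ?_⟩
    · refine IsGreatest.csSup_eq ⟨⟨0, by simp [SquarePath.OnPath]⟩, ?_⟩
      rintro t ⟨y, hy, -⟩
      have hy : y + t ≤ 0 := hy
      omega
    · exact diagonalWord_of_size_zero emptyPath

end EmptyWord

end ScheduleFormula

/-! ### The schedule formula. -/

theorem mainTheorem1 {A : Type*} [CommRing A] (q : Aˣ) (t : A) (x : ℕ → A)
    (z : ScheduleFormula.MarkedWord) (s : ℕ)
    (hsorted : ∀ ρ ∈ ScheduleFormula.runs z, ρ.Pairwise (fun a b => a ≤ b))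
    (hbase : z ≠ [] → ∃ a ∈ ScheduleFormula.run z 0, 0 < a.val)
    (hempty : z = [] → s = 0) :
    (ScheduleFormula.pathsWith s z).Finite ∧
    ∑ᶠ P ∈ ScheduleFormula.pathsWith s z,
        ((q ^ P.2.dinv : Aˣ) : A) * t ^ P.2.area * P.2.monomial x =
      t ^ ScheduleFormula.maj z * ((q ^ ScheduleFormula.bonus z s : Aˣ) : A) *
        (∏ i ∈ Finset.range (ScheduleFormula.runs z).length, ∏ᶠ c : ℕ,
          (ScheduleFormula.qBinom (q : A)
              (ScheduleFormula.schedule z s i c + ScheduleFormula.mult z i c - 1)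
              (ScheduleFormula.mult z i c)
            * (q : A) ^ (ScheduleFormula.markedMult z i c).choose 2
            * ScheduleFormula.qBinom (q : A) (ScheduleFormula.markedSchedule z s i c)
              (ScheduleFormula.markedMult z i c))) *
        ScheduleFormula.wordMonomial x z := by
  open ScheduleFormula in
  -- The empty path is treated separately, since the empty word of cells is not a chain from
  -- `startCell` to `stopCell`.
  by_cases hz : z = []
  · obtain rfl := hempty hz
    subst hz
    rw [pathsWith_nil]
    refine ⟨Set.finite_singleton _, ?_⟩
    rw [finsum_mem_singleton, dinv_eq]
    simp [DecoratedSquarePath.toCells, invCount, DecoratedSquarePath.area,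
      DecoratedSquarePath.monomial, maj, majorIndex, bonus, runs, wordMonomial]
  · have hM := unmarkedCells_add_markedCells z s
    obtain ⟨N, hN⟩ : ∃ N, ∀ v ∈ allCells z s, v.2.1 < N :=
      ⟨((allCells z s).toFinset.sup fun v => v.2.1) + 1, fun v hv => Nat.lt_succ_of_le
        (Finset.le_sup (f := fun v : Cell => v.2.1) (Multiset.mem_toFinset.2 hv))⟩
    have hlt : ∀ i, run z i ≠ [] → i < (runs z).length := fun i h => by
      by_contra h'
      exact h (run_eq_nil z (by omega))
    have hN1 : ∀ i, ∀ c ∈ unmarkedRun z i, c < N := by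
      intro i c hc
      obtain ⟨a, ha, rfl⟩ := List.mem_map.1 hc
      have ha := (List.mem_filter.1 ha).1
      exact hN _ (mem_allCells.2 ⟨i, hlt i (List.ne_nil_of_mem ha), a, ha, rfl⟩)
    have hN2 : ∀ i, ∀ c ∈ markedRun z i, c < N := by
      intro i c hc
      obtain ⟨a, ha, rfl⟩ := List.mem_map.1 hc
      have ha := (List.mem_filter.1 ha).1
      exact hN _ (mem_allCells.2 ⟨i, hlt i (List.ne_nil_of_mem ha), a, ha, rfl⟩)
    have hrun : ∃ i, run z i ≠ [] := by
      obtain ⟨a, ha, -⟩ := hbase hz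
      exact ⟨0, List.ne_nil_of_mem ha⟩
    have hbij := bijOn_toCells (s := s) hz hsorted (hbase hz) hN
    refine ⟨hbij.finite_iff_finite.2 (Finset.finite_toSet _), ?_⟩
    have hfactor : ∀ i ∈ Finset.range (runs z).length, ∏ᶠ c : ℕ,
        (qBinom (q : A) (schedule z s i c + mult z i c - 1) (mult z i c)
            * (q : A) ^ (markedMult z i c).choose 2
            * qBinom (q : A) (markedSchedule z s i c) (markedMult z i c)) =
        ∏ c ∈ Finset.range N, (unmarkedFactor (q : A) z s i c *
          (q : A) ^ (markedMult z i c).choose 2 * markedFactor (q : A) z s i c) := by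
      intro i _
      refine finprod_eq_prod_of_mulSupport_subset _ fun c hc => ?_
      rw [Finset.mem_coe, Finset.mem_range]
      by_contra h
      refine hc ?_
      have h1 : mult z i c = 0 := List.count_eq_zero.2 fun h' => h (hN1 i c h')
      have h2 : markedMult z i c = 0 := List.count_eq_zero.2 fun h' => h (hN2 i c h')
      simp [h1, h2]
    rw [Finset.prod_congr rfl hfactor]
    have hsum := sum_arrangements_cells (s := s) (q : A) N hN1 hN2 hrun
    rw [hM] at hsum
    -- The part of the dinv that depends only on the multiset of cells; it may be negative, which is
    -- why `q` is a unit.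
    set K : ℤ := ((allCells z s).countP (fun u => u.1 < 0 ∧ 0 < u.2.1) : ℕ) -
      ((markedCells z s).card : ℤ) with hK
    have hcount : (allCells z s).countP (fun u => u.2.2 = true) = (markedCells z s).card := by
      rw [← hM, Multiset.countP_add, Multiset.countP_eq_zero.2, Multiset.countP_eq_card.2, zero_add]
      · intro u hu
        obtain ⟨i, -, c, -, rfl⟩ := mem_cells.1 hu
        rfl
      · intro u hu
        obtain ⟨i, -, c, -, rfl⟩ := mem_cells.1 hu
        simp
    rw [finsum_mem_eq_of_bijOn (g := fun l => (q : A) ^ invCount Attacks l *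
      (((q ^ K : Aˣ) : A) * t ^ maj z * wordMonomial x z)) _ hbij, finsum_mem_coe_finset,
      ← Finset.sum_mul, Finset.sum_filter]
    · have hexp : ((q ^ bonus z s : Aˣ) : A) =
          (q : A) ^ (markedCells z s).countP (fun v => ¬ Follows startCell v) *
            ((q ^ K : Aˣ) : A) := by
        rw [← bonus_eq, hM, add_sub_assoc, ← hK, zpow_add, zpow_natCast, Units.val_mul,
          Units.val_pow_eq_pow_val]
      rw [show (∑ l ∈ arrangements (allCells z s),
        if List.IsChain Follows (startCell :: (l ++ [stopCell N])) then
          (q : A) ^ invCount Attacks l else 0) = _ from hsum, hexp]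
      ring
    · rintro ⟨n, P⟩ hP
      have hmem := hbij.1 hP
      obtain ⟨-, hw⟩ := hP
      simp only at hw hmem ⊢
      rw [Finset.mem_coe, Finset.mem_filter, mem_arrangements] at hmem
      have hn : 0 < n := by
        by_contra h
        obtain rfl : n = 0 := by omega
        have := hmem.2
        simp [DecoratedSquarePath.toCells, follows_of_unmarked, startCell, stopCell] at this
      rw [dinv_eq, area_eq P hn, monomial_eq, hw, ← Multiset.coe_countP, ← Multiset.coe_countP,
        hmem.1, hcount, add_sub_assoc, ← hK, zpow_add, zpow_natCast, Units.val_mul,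
        Units.val_pow_eq_pow_val]
      ring
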